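/- Let $\mathcal{M}=\bigcup_j \mathcal{M}_j\subset\mathbb{R}^D$ be a countable union, where $\mathcal{M}_j$ is a smooth $d_j$-dimensional embedded submanifold of $\mathbb{R}^D$ and $$\xi := \inf_{i\neq j}\ \inf_{x_i\in\mathcal{M}_i,\ x_j\in\mathcal{M}_j}\|x_i-x_j\|>0$$ (with $\xi=+\infty$ if there is only one submanifold). Let $p$ be a probability density on $\mathcal{M}$ with respect to the Riemannian measure $\mathrm{d}x'$ of $\mathcal{M}$ (which on each $\mathcal{M}_j$ is the Riemannian measure of the metric induced by $\mathbb{R}^D$), written as $p(x)=\pi_j p_j(x)$ for $x\in\mathcal{M}_j$, where every $p_j$ is a probability density on $\mathcal{M}_j$, $\pi_j>0$ and $\sum_j\pi_j=1$. For $\delta\in\mathbb{R}$ let $$\varrho_{\mathcal{U}}(x,\delta):=\int_{\mathcal{M}}p(x')\,\pi^{-D/2}\,\Gamma\!\left(\tfrac D2+1\right)e^{-D\delta}\,\mathbf{1}\big(\|x-x'\|<e^{\delta}\big)\,\mathrm{d}x'$$ be the convolution of $p$ with the uniform distribution on the ball of radius $e^\delta$ in $\mathbb{R}^D$ (here $\pi$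 without index is the number $3.14\ldots$). Let $x\in\mathcal{M}_i$ be such that $p_i$ (as a function on $\mathcal{M}_i$) is continuous at $x$ and $p_i(x)>0$. Then $\varrho_{\mathcal{U}}(x,\delta)>0$ for all $\delta\in\mathbb{R}$, the function $\delta\mapsto\log\varrho_{\mathcal{U}}(x,\delta)$ is differentiable at almost every $\delta\in\mathbb{R}$, and $$\lim_{\delta\to-\infty}\frac{\partial}{\partial\delta}\log\varrho_{\mathcal{U}}(x,\delta)=d_i-D,$$ the limit being taken over those $\delta$ at which the derivative exists. If moreover $p_i$ is continuous on a neighbourhood of $x$ in $\mathcal{M}_i$, then the derivative exists for all sufficiently negative $\delta$, so that the limit is an ordinary one. -/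

import Mathlib

open MeasureTheory Set Filter Topology
open scoped ContDiff ENNReal

noncomputable section

/-- A smooth local parametrization `φ : U → M` of a subset `M` of `ℝ^D` by an open subset `U` of
`ℝ^d`: a smooth immersion on `U` which is a homeomorphism from `U` onto a relatively open subset
of `M`. Only the values of `toFun` on `U` matter. -/
structure LocalParametrization {D : ℕ} (M : Set (EuclideanSpace ℝ (Fin D))) (d : ℕ) where
  /-- the parameter domain -/
  U : Set (EuclideanSpace ℝ (Fin d))
  /-- the parametrization -/
  toFun : EuclideanSpace ℝ (Fin d) → EuclideanSpace ℝ (Fin D)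
  isOpen_U : IsOpen U
  smooth : ContDiffOn ℝ ∞ toFun U
  immersion : ∀ u ∈ U, Function.Injective (fderiv ℝ toFun u)
  embedding : IsEmbedding fun u : U => toFun u
  isOpen_image : ∃ V : Set (EuclideanSpace ℝ (Fin D)), IsOpen V ∧ toFun '' U = M ∩ V

/-- The volume density `√(det g)`, where `g_{kl} = ⟪∂_k φ, ∂_l φ⟫` is the matrix of the induced
Riemannian metric in the coordinates given by the parametrization. -/
def LocalParametrization.volumeDensity {D : ℕ} {M : Set (EuclideanSpace ℝ (Fin D))} {d : ℕ}
    (P : LocalParametrization M d) (u : EuclideanSpace ℝ (Fin d)) : ℝ :=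
  √(Matrix.det (Matrix.of fun k l : Fin d =>
    inner ℝ (fderiv ℝ P.toFun u (EuclideanSpace.single k 1))
      (fderiv ℝ P.toFun u (EuclideanSpace.single l 1))))

/-- The Riemannian measure on the coordinate patch `φ(U)`: the image under `φ` of the measure
`√(det g) du` on `U`. -/
def LocalParametrization.patchMeasure {D : ℕ} {M : Set (EuclideanSpace ℝ (Fin D))} {d : ℕ}
    (P : LocalParametrization M d) : Measure (EuclideanSpace ℝ (Fin D)) :=
  ((volume.restrict P.U).withDensity fun u => ENNReal.ofReal (P.volumeDensity u)).map P.toFun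

/-- `M` is a smooth `d`-dimensional embedded submanifold (without boundary) of `ℝ^D`. -/
def IsEmbeddedSubmanifold {D : ℕ} (M : Set (EuclideanSpace ℝ (Fin D))) (d : ℕ) : Prop :=
  ∀ x ∈ M, ∃ P : LocalParametrization M d, x ∈ P.toFun '' P.U

/-- The Riemannian measure of a smooth `d`-dimensional embedded submanifold `M` of `ℝ^D` with the
induced metric, as a Borel measure on `ℝ^D` carried by `M`. The patch measures agree on overlaps
and countably many patches cover `M`, so the measure obtained by gluing them is the least measure
which is at least as large as every patch measure. -/
def riemannianMeasure {D : ℕ} (M : Set (EuclideanSpace ℝ (Fin D))) (d : ℕ) :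
    Measure (EuclideanSpace ℝ (Fin D)) :=
  ⨆ P : LocalParametrization M d, P.patchMeasure

/-- `f` is (on `M`) a probability density with respect to the Riemannian measure of `M`. -/
structure IsProbabilityDensityOn {D : ℕ} (M : Set (EuclideanSpace ℝ (Fin D))) (d : ℕ)
    (f : EuclideanSpace ℝ (Fin D) → ℝ) : Prop where
  nonneg : ∀ y ∈ M, 0 ≤ f y
  integrable : Integrable f (riemannianMeasure M d)
  integral_eq_one : ∫ y, f y ∂(riemannianMeasure M d) = 1

/-- The density at `x` of the uniform distribution on the open ball of radius `e^δ` centred at `μ`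
in `ℝ^D`. -/
def uniformDensity {D : ℕ} (x μ : EuclideanSpace ℝ (Fin D)) (δ : ℝ) : ℝ :=
  Real.pi ^ (-(D : ℝ) / 2) * Real.Gamma ((D : ℝ) / 2 + 1) * Real.exp (-(D : ℝ) * δ) *
    (Metric.ball μ (Real.exp δ)).indicator (fun _ => (1 : ℝ)) x

/-- The convolution `ϱ_U(x, δ) = ∫_M p(x') U_D(x - x'; 0, δ) dx'` of `p` with uniform noise, where
`M` is the disjoint union of the `d j`-dimensional submanifolds `M j` and `dx'` is the Riemannian
measure of `M`, i.e. the sum of those of the `M j`. -/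
def uniformConvolution {D : ℕ} {ι : Type*} (M : ι → Set (EuclideanSpace ℝ (Fin D))) (d : ι → ℕ)
    (p : EuclideanSpace ℝ (Fin D) → ℝ) (x : EuclideanSpace ℝ (Fin D)) (δ : ℝ) : ℝ :=
  ∫ y, p y * uniformDensity (x - y) 0 δ ∂(Measure.sum fun j => riemannianMeasure (M j) (d j))

end

/-! Write `F r` for the integral of `p` over the ball of radius `r` about `x`. The convolution
equals `C * exp (-D * δ) * F (exp δ)`, so its logarithmic derivative in `δ` is `r * F' r / F r - D`
with `r = exp δ`. What has to be shown is that `r * F' r / F r` tends to `d i` as `r` tends to `0`.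
By the separation hypothesis only `M i` contributes for small `r`.

If `p` is continuous on `M i` near `x`, use a chart in which the distance to `x` is the norm of the
parameter (`IsEmbeddedSubmanifold.exists_radial_chart`). Then `F r` is the integral of a continuous
function over the ball of radius `r` in `ℝ^d`. In polar coordinates `F' r = r ^ (d - 1) * S r` with
`S` continuous and `S 0 > 0`, hence `F r ~ S 0 * r ^ d / d` (`deriv_integral_ball`; dimension `0` is
separate).

If `p` is continuous only at `x`, compare `F` with the volume `G r` of the part of `M i` in the
ball. The increments of `F` lie between `p x - η` and `p x + η` times those of `G`. So `F / G` tends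
to `p x`, and `|F' - p x * G'| ≤ η * G'` wherever `F'` exists. The quotients `r * F' / F` and `r *
G' / G` therefore have the same limit (`tendsto_logDeriv_of_comparable`), and the first case applies
to `G`. Differentiability almost everywhere comes from the monotonicity of `F`. -/

/-! ### Volume scaling of linear maps -/

/-- The factor by which a linear map scales `d`-dimensional volume. -/
noncomputable def volumeFactor {d D : ℕ}
    (A : EuclideanSpace ℝ (Fin d) →L[ℝ] EuclideanSpace ℝ (Fin D)) : ℝ :=
  √(Matrix.gram ℝ fun k : Fin d => A (EuclideanSpace.single k 1)).det

/-- If `N` is the matrix of `B`, the Gram matrix `G` of `A` becomes `Nᵀ * G * N`; its determinant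
gains the factor `B.det ^ 2`, whose root is `|B.det|`. -/
lemma volumeFactor_comp {d D : ℕ}
    (A : EuclideanSpace ℝ (Fin d) →L[ℝ] EuclideanSpace ℝ (Fin D))
    (B : EuclideanSpace ℝ (Fin d) →L[ℝ] EuclideanSpace ℝ (Fin d)) :
    volumeFactor (A.comp B) = volumeFactor A * |B.det| := by
  classical
  set b := (EuclideanSpace.basisFun (Fin d) ℝ).toBasis with hb
  set N := LinearMap.toMatrix b b (B : EuclideanSpace ℝ (Fin d) →ₗ[ℝ] _) with hN
  have hexp : ∀ k, B (EuclideanSpace.single k 1) = ∑ l, N l k • EuclideanSpace.single l (1:ℝ) := by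
    intro k
    have := b.sum_repr (B (EuclideanSpace.single k 1))
    rw [← this]
    refine Finset.sum_congr rfl fun l _ => ?_
    simp [hN, LinearMap.toMatrix_apply, hb]
  have hgram : (Matrix.gram ℝ fun k : Fin d => (A.comp B) (EuclideanSpace.single k 1)) =
      N.transpose * (Matrix.gram ℝ fun k : Fin d => A (EuclideanSpace.single k 1)) * N := by
    ext k l
    simp only [Matrix.gram_apply, ContinuousLinearMap.comp_apply, hexp, map_sum, map_smul,
      Matrix.mul_apply, Matrix.transpose_apply, sum_inner, inner_sum, inner_smul_left,
      inner_smul_right, Finset.sum_mul, Finset.mul_sum, conj_trivial]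
    exact Finset.sum_congr rfl fun i _ => Finset.sum_congr rfl fun j _ => by ring
  have hdet : N.det = B.det := by
    rw [hN, LinearMap.det_toMatrix, ContinuousLinearMap.det]
  rw [volumeFactor, hgram, Matrix.det_mul, Matrix.det_mul, Matrix.det_transpose, hdet, volumeFactor,
    show B.det * (Matrix.gram ℝ fun k : Fin d => A (EuclideanSpace.single k 1)).det * B.det =
      (Matrix.gram ℝ fun k : Fin d => A (EuclideanSpace.single k 1)).det * B.det ^ 2 by ring,
    Real.sqrt_mul' _ (sq_nonneg _), Real.sqrt_sq_eq_abs]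

lemma continuous_volumeFactor {d D : ℕ} :
    Continuous (volumeFactor : (EuclideanSpace ℝ (Fin d) →L[ℝ] EuclideanSpace ℝ (Fin D)) → ℝ) := by
  unfold volumeFactor
  refine Real.continuous_sqrt.comp (Continuous.matrix_det ?_)
  refine continuous_matrix fun k l => ?_
  simp only [Matrix.gram_apply]
  fun_prop

lemma volumeFactor_pos {d D : ℕ}
    {A : EuclideanSpace ℝ (Fin d) →L[ℝ] EuclideanSpace ℝ (Fin D)} (hA : Function.Injective A) :
    0 < volumeFactor A := by
  refine Real.sqrt_pos.2 (Matrix.PosDef.det_pos ?_)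
  rw [Matrix.posDef_gram_iff_linearIndependent]
  have hker : LinearMap.ker A.toLinearMap = ⊥ := LinearMap.ker_eq_bot.2 hA
  have := (EuclideanSpace.basisFun (Fin d) ℝ).toBasis.linearIndependent.map' A.toLinearMap hker
  have e : (fun k : Fin d => A (EuclideanSpace.single k 1)) =
      A.toLinearMap ∘ (EuclideanSpace.basisFun (Fin d) ℝ).toBasis := by
    ext k : 1
    simp
  rw [e]
  exact this

lemma ContinuousOn.measurableSet_inter_preimage {X Y : Type*} [TopologicalSpace X]
    [MeasurableSpace X] [OpensMeasurableSpace X] [TopologicalSpace Y] [MeasurableSpace Y]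
    [BorelSpace Y] {f : X → Y} {s : Set X} (hf : ContinuousOn f s) (hs : MeasurableSet s)
    {t : Set Y} (ht : MeasurableSet t) : MeasurableSet (s ∩ f ⁻¹' t) := by
  have := hs.subtype_image (hf.domRestrict.measurable ht)
  convert this using 1
  ext u; simp [and_comm]

/-! ### Coordinate patches and the gluing of their measures -/

namespace LocalParametrization
variable {D d : ℕ} {M : Set (EuclideanSpace ℝ (Fin D))} (P Q : LocalParametrization M d)

lemma continuousOn : ContinuousOn P.toFun P.U := P.smooth.continuousOn

lemma injOn : InjOn P.toFun P.U := fun a ha b hb h => by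
  have := P.embedding.injective (a₁ := ⟨a, ha⟩) (a₂ := ⟨b, hb⟩) h
  simpa using this

lemma image_subset : P.toFun '' P.U ⊆ M := by
  obtain ⟨V, -, hV⟩ := P.isOpen_image
  rw [hV]; exact inter_subset_left

lemma measurableSet_image : MeasurableSet (P.toFun '' P.U) :=
  P.isOpen_U.measurableSet.image_of_continuousOn_injOn P.continuousOn P.injOn

lemma patchMeasure_apply {T : Set (EuclideanSpace ℝ (Fin D))} (hT : MeasurableSet T) :
    P.patchMeasure T = ∫⁻ u in P.U ∩ P.toFun ⁻¹' T,
      ENNReal.ofReal (volumeFactor (fderiv ℝ P.toFun u)) := by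
  have hU := P.isOpen_U.measurableSet
  have hφ : AEMeasurable P.toFun (volume.restrict P.U) := P.continuousOn.aemeasurable hU
  rw [patchMeasure, Measure.map_apply_of_aemeasurable
    (hφ.mono_ac (withDensity_absolutelyContinuous _ _)) hT, withDensity_apply',
    Measure.restrict_restrict' hU, inter_comm]
  rfl

lemma hasStrictFDerivAt {u : EuclideanSpace ℝ (Fin d)} (hu : u ∈ P.U) :
    HasStrictFDerivAt P.toFun (fderiv ℝ P.toFun u) u :=
  (P.smooth.contDiffAt (P.isOpen_U.mem_nhds hu)).hasStrictFDerivAt (by simp)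

/-- Change of variables for the volume density under a differentiable injection. -/
lemma lintegral_image_volumeFactor {S : Set (EuclideanSpace ℝ (Fin d))} (hS : MeasurableSet S)
    {τ : EuclideanSpace ℝ (Fin d) → EuclideanSpace ℝ (Fin d)}
    {τ' : EuclideanSpace ℝ (Fin d) → EuclideanSpace ℝ (Fin d) →L[ℝ] EuclideanSpace ℝ (Fin d)}
    (hτ : ∀ v ∈ S, HasFDerivAt τ (τ' v) v) (hinj : InjOn τ S) :
    ∫⁻ u in τ '' S, ENNReal.ofReal (volumeFactor (fderiv ℝ P.toFun u)) =
      ∫⁻ v in S, ENNReal.ofReal (volumeFactor ((fderiv ℝ P.toFun (τ v)).comp (τ' v))) := by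
  rw [lintegral_image_eq_lintegral_abs_det_fderiv_mul volume hS
    (fun v hv => (hτ v hv).hasFDerivWithinAt) hinj]
  refine lintegral_congr fun v => ?_
  rw [volumeFactor_comp, mul_comm, ENNReal.ofReal_mul (show 0 ≤ volumeFactor _ from Real.sqrt_nonneg _)]

/-- A continuous lift through an immersion of a differentiable map is differentiable. -/
lemma differentiableAt_of_comp {τ : EuclideanSpace ℝ (Fin d) → EuclideanSpace ℝ (Fin d)}
    {ψ : EuclideanSpace ℝ (Fin d) → EuclideanSpace ℝ (Fin D)} {w : EuclideanSpace ℝ (Fin d)}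
    (hτw : τ w ∈ P.U) (hτ : ContinuousAt τ w) (hψ : DifferentiableAt ℝ ψ w)
    (h : ∀ᶠ v in 𝓝 w, P.toFun (τ v) = ψ v) : DifferentiableAt ℝ τ w := by
  have hA := P.hasStrictFDerivAt hτw
  -- With `L` a left inverse of the derivative, `L ∘ P.toFun` has derivative the identity and is
  -- locally invertible. This exhibits `τ` near `w` as that local inverse applied to `L ∘ ψ`.
  obtain ⟨L, hL⟩ := LinearMap.exists_leftInverse_of_injective
    ((fderiv ℝ P.toFun (τ w)) : EuclideanSpace ℝ (Fin d) →ₗ[ℝ] EuclideanSpace ℝ (Fin D))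
    (LinearMap.ker_eq_bot.2 (P.immersion _ hτw))
  have hLA : (L.toContinuousLinearMap).comp (fderiv ℝ P.toFun (τ w)) =
      ((ContinuousLinearEquiv.refl ℝ (EuclideanSpace ℝ (Fin d)) :
        EuclideanSpace ℝ (Fin d) ≃L[ℝ] EuclideanSpace ℝ (Fin d)) :
        EuclideanSpace ℝ (Fin d) →L[ℝ] EuclideanSpace ℝ (Fin d)) := by
    ext1 v
    exact LinearMap.congr_fun hL v
  have hstrict := (L.toContinuousLinearMap.hasStrictFDerivAt (x := P.toFun (τ w))).comp (τ w) hA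
  rw [hLA] at hstrict
  have hinv := hstrict.to_localInverse
  have hev := hstrict.eventually_left_inverse
  have : τ =ᶠ[𝓝 w] fun v => hstrict.localInverse _ _ _ (L.toContinuousLinearMap (ψ v)) := by
    filter_upwards [hτ.eventually hev, h] with v hv h2
    rw [← h2]; exact hv.symm
  refine DifferentiableAt.congr_of_eventuallyEq ?_ this
  rw [h.self_of_nhds] at hinv
  exact DifferentiableAt.comp w hinv.hasFDerivAt.differentiableAt
    (L.toContinuousLinearMap.differentiableAt.comp w hψ)

lemma isOpen_inter_preimage_image : IsOpen (Q.U ∩ Q.toFun ⁻¹' (P.toFun '' P.U)) := by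
  obtain ⟨V, hV, hVe⟩ := P.isOpen_image
  have : Q.U ∩ Q.toFun ⁻¹' (P.toFun '' P.U) = Q.U ∩ Q.toFun ⁻¹' V := by
    ext w
    simp only [hVe, mem_inter_iff, mem_preimage]
    exact ⟨fun h => ⟨h.1, h.2.2⟩, fun h => ⟨h.1, Q.image_subset ⟨w, h.1, rfl⟩, h.2⟩⟩
  rw [this]
  exact Q.continuousOn.isOpen_inter_preimage Q.isOpen_U hV

lemma exists_transition : ∃ τ : EuclideanSpace ℝ (Fin d) → EuclideanSpace ℝ (Fin d),
    ∀ w ∈ Q.U ∩ Q.toFun ⁻¹' (P.toFun '' P.U), τ w ∈ P.U ∧ P.toFun (τ w) = Q.toFun w ∧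
      DifferentiableAt ℝ τ w := by
  set W := Q.U ∩ Q.toFun ⁻¹' (P.toFun '' P.U) with hW
  have hWo : IsOpen W := P.isOpen_inter_preimage_image Q
  choose! τ hτU hτ using fun w (hw : w ∈ W) => hw.2
  refine ⟨τ, fun w hw => ⟨hτU w hw, hτ w hw, ?_⟩⟩
  have hcont : ContinuousOn τ W := by
    rw [continuousOn_iff_continuous_domRestrict]
    have h1 : Continuous fun v : W => (⟨τ v, hτU v v.2⟩ : P.U) := by
      rw [P.embedding.continuous_iff]
      have : ContinuousOn Q.toFun W := Q.continuousOn.mono inter_subset_left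
      refine (continuousOn_iff_continuous_domRestrict.1 this).congr fun v => ?_
      exact (hτ v v.2).symm
    exact continuous_subtype_val.comp h1
  refine P.differentiableAt_of_comp (hτU w hw) (hcont.continuousAt (hWo.mem_nhds hw))
    (Q.hasStrictFDerivAt hw.1).hasFDerivAt.differentiableAt ?_
  filter_upwards [hWo.mem_nhds hw] with v hv using hτ v hv

/-- By the chain rule for the transition map, the density of `Q` is that of `P` times the Jacobian,
so change of variables applies. An inequality is enough, since the Riemannian measure is a supremum
of patch measures. -/
lemma patchMeasure_restrict_le :
    Q.patchMeasure.restrict (P.toFun '' P.U) ≤ P.patchMeasure := by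
  obtain ⟨τ, hτ⟩ := exists_transition P Q
  refine Measure.le_iff.2 fun T hT => ?_
  rw [Measure.restrict_apply hT, Q.patchMeasure_apply (hT.inter P.measurableSet_image),
    P.patchMeasure_apply hT]
  set S := Q.U ∩ Q.toFun ⁻¹' (T ∩ P.toFun '' P.U) with hS
  have hSm : MeasurableSet S := Q.continuousOn.measurableSet_inter_preimage
    Q.isOpen_U.measurableSet (hT.inter P.measurableSet_image)
  have hSW : ∀ v ∈ S, v ∈ Q.U ∩ Q.toFun ⁻¹' (P.toFun '' P.U) := fun v hv => ⟨hv.1, hv.2.2⟩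
  have hWo := P.isOpen_inter_preimage_image Q
  have hinj : InjOn τ S := fun a ha b hb hab => Q.injOn ha.1 hb.1 <| by
    rw [← (hτ a (hSW a ha)).2.1, ← (hτ b (hSW b hb)).2.1, hab]
  calc ∫⁻ w in S, ENNReal.ofReal (volumeFactor (fderiv ℝ Q.toFun w))
      = ∫⁻ v in S, ENNReal.ofReal
          (volumeFactor ((fderiv ℝ P.toFun (τ v)).comp (fderiv ℝ τ v))) := by
        refine setLIntegral_congr_fun hSm fun v hv => ?_
        obtain ⟨h1, h2, h3⟩ := hτ v (hSW v hv)
        have hc : HasFDerivAt (P.toFun ∘ τ) ((fderiv ℝ P.toFun (τ v)).comp (fderiv ℝ τ v)) v :=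
          (P.hasStrictFDerivAt h1).hasFDerivAt.comp v h3.hasFDerivAt
        have he : P.toFun ∘ τ =ᶠ[𝓝 v] Q.toFun := by
          filter_upwards [hWo.mem_nhds (hSW v hv)] with y hy using (hτ y hy).2.1
        rw [← hc.fderiv, he.fderiv_eq]
    _ = ∫⁻ u in τ '' S, ENNReal.ofReal (volumeFactor (fderiv ℝ P.toFun u)) :=
        (P.lintegral_image_volumeFactor hSm
          (fun v hv => (hτ v (hSW v hv)).2.2.hasFDerivAt) hinj).symm
    _ ≤ _ := by
        refine lintegral_mono_set ?_
        rintro _ ⟨v, hv, rfl⟩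
        obtain ⟨h1, h2, -⟩ := hτ v (hSW v hv)
        exact ⟨h1, by rw [mem_preimage, h2]; exact hv.2.1⟩

lemma patchMeasure_compl_image : P.patchMeasure (P.toFun '' P.U)ᶜ = 0 := by
  rw [P.patchMeasure_apply P.measurableSet_image.compl]
  have : P.U ∩ P.toFun ⁻¹' (P.toFun '' P.U)ᶜ = ∅ := by
    ext u
    simp only [mem_inter_iff, mem_preimage, mem_compl_iff, mem_empty_iff_false, iff_false, not_and,
      not_not]
    exact fun hu => ⟨u, hu, rfl⟩
  rw [this]; simp

lemma riemannianMeasure_restrict_image :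
    (riemannianMeasure M d).restrict (P.toFun '' P.U) = P.patchMeasure := by
  set s := P.toFun '' P.U with hs
  have hsm : MeasurableSet s := P.measurableSet_image
  -- The right side is at least every patch measure: on `s` by the overlap estimate, off `s` by the
  -- definition of the supremum.
  have hle : riemannianMeasure M d ≤ P.patchMeasure + (riemannianMeasure M d).restrict sᶜ := by
    refine iSup_le fun Q => ?_
    rw [← Measure.restrict_add_restrict_compl (μ := Q.patchMeasure) hsm]
    exact add_le_add (P.patchMeasure_restrict_le Q)
      (Measure.restrict_mono le_rfl (le_iSup (fun Q : LocalParametrization M d => Q.patchMeasure) Q))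
  refine le_antisymm ?_ ?_
  · have := Measure.restrict_mono (le_refl s) hle
    refine this.trans ?_
    rw [Measure.restrict_add, Measure.restrict_restrict hsm, inter_compl_self,
      Measure.restrict_empty, add_zero]
    exact Measure.restrict_le_self
  · have h1 : P.patchMeasure.restrict s = P.patchMeasure :=
      Measure.restrict_eq_self_of_ae_mem (by
        rw [ae_iff]; exact P.patchMeasure_compl_image)
    rw [← h1]
    exact Measure.restrict_mono le_rfl (le_iSup (fun Q : LocalParametrization M d => Q.patchMeasure) P)

end LocalParametrization

/-- `M` is second countable, so countably many patches cover it, and each patch is an injective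
continuous image of an open set. -/
lemma IsEmbeddedSubmanifold.measurableSet {D d : ℕ} {M : Set (EuclideanSpace ℝ (Fin D))}
    (hM : IsEmbeddedSubmanifold M d) : MeasurableSet M := by
  rcases M.eq_empty_or_nonempty with rfl | ⟨x₀, hx₀⟩
  · exact MeasurableSet.empty
  have : Nonempty (LocalParametrization M d) := ⟨(hM x₀ hx₀).choose⟩
  choose! P hP using hM
  have hn : ∀ x ∈ M, (P x).toFun '' (P x).U ∈ 𝓝[M] x := fun x hx => by
    obtain ⟨V, hV, hVe⟩ := (P x).isOpen_image
    rw [hVe]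
    have : x ∈ V := by have := hP x hx; rw [hVe] at this; exact this.2
    exact inter_mem self_mem_nhdsWithin (mem_nhdsWithin_of_mem_nhds (hV.mem_nhds this))
  obtain ⟨t, htM, htc, hcov⟩ := TopologicalSpace.countable_cover_nhdsWithin hn
  have : M = ⋃ x ∈ t, (P x).toFun '' (P x).U :=
    hcov.antisymm (iUnion₂_subset fun x _ => (P x).image_subset)
  rw [this]
  exact MeasurableSet.biUnion htc fun x _ => (P x).measurableSet_image

lemma IsEmbeddedSubmanifold.ae_mem {D d : ℕ} {M : Set (EuclideanSpace ℝ (Fin D))}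
    (hM : IsEmbeddedSubmanifold M d) : ∀ᵐ y ∂(riemannianMeasure M d), y ∈ M := by
  have hle : riemannianMeasure M d ≤ (riemannianMeasure M d).restrict M := by
    refine iSup_le fun Q => ?_
    have h1 : Q.patchMeasure.restrict M = Q.patchMeasure :=
      Measure.restrict_eq_self_of_ae_mem (by
        rw [ae_iff]
        exact measure_mono_null (compl_subset_compl.2 Q.image_subset) Q.patchMeasure_compl_image)
    rw [← h1]
    exact Measure.restrict_mono le_rfl (le_iSup (fun Q : LocalParametrization M d => Q.patchMeasure) Q)
  exact ae_mono hle (ae_restrict_mem hM.measurableSet)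

/-! ### Radial rescaling -/

/-- The map which rescales each ray so that `‖radialRescaling χ u‖ = ‖χ u‖`. -/
noncomputable def radialRescaling {E F : Type*} [NormedAddCommGroup E] [InnerProductSpace ℝ E]
    [NormedAddCommGroup F] (χ : E → F) (u : E) : E :=
  (‖χ u‖ / ‖u‖) • u

lemma norm_radialRescaling {E F : Type*} [NormedAddCommGroup E] [InnerProductSpace ℝ E]
    [NormedAddCommGroup F] {χ : E → F} (h0 : χ 0 = 0) (u : E) : ‖radialRescaling χ u‖ = ‖χ u‖ := by
  rcases eq_or_ne u 0 with rfl | hu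
  · simp [radialRescaling, h0]
  · have : ‖u‖ ≠ 0 := norm_ne_zero_iff.2 hu
    rw [radialRescaling, norm_smul, Real.norm_of_nonneg (by positivity)]
    field_simp

section radialRescaling

variable {E F : Type*} [NormedAddCommGroup E] [InnerProductSpace ℝ E]
  [NormedAddCommGroup F] [InnerProductSpace ℝ F] {χ : E → F}

/-- The rescaled vector stays on the ray of `u`, so the left side is `|‖χ u‖ - ‖A u‖|`. -/
lemma norm_radialRescaling_sub_le (A : E →L[ℝ] F) (hA : ∀ u, ‖A u‖ = ‖u‖) (u : E) :
    ‖radialRescaling χ u - u‖ ≤ ‖χ u - A u‖ := by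
  rcases eq_or_ne u 0 with rfl | hu
  · simp [radialRescaling]
  · have hu' : ‖u‖ ≠ 0 := norm_ne_zero_iff.2 hu
    have : radialRescaling χ u - u = ((‖χ u‖ - ‖u‖) / ‖u‖) • u := by
      rw [radialRescaling, sub_div, div_self hu', sub_smul, one_smul]
    rw [this, norm_smul, norm_div, norm_norm, div_mul_cancel₀ _ hu', ← hA u]
    exact abs_norm_sub_norm_le _ _

lemma hasFDerivAt_radialRescaling_zero {A : E →L[ℝ] F} (h0 : χ 0 = 0) (hχ : HasFDerivAt χ A 0)
    (hA : ∀ u, ‖A u‖ = ‖u‖) :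
    HasFDerivAt (radialRescaling χ) (ContinuousLinearMap.id ℝ E) 0 := by
  rw [hasFDerivAt_iff_isLittleO_nhds_zero] at hχ ⊢
  refine Asymptotics.IsBigO.trans_isLittleO (Asymptotics.isBigO_of_le _ fun u => ?_) hχ
  simpa [h0, radialRescaling] using norm_radialRescaling_sub_le (χ := χ) A hA u

lemma hasFDerivAt_norm_comp {A' : E →L[ℝ] F} {u : E} (hχ : HasFDerivAt χ A' u) (hu : χ u ≠ 0) :
    HasFDerivAt (fun v => ‖χ v‖) (‖χ u‖⁻¹ • (innerSL ℝ (χ u)).comp A') u := by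
  have h1 := (hχ.norm_sq).sqrt (by positivity)
  have h2 : (fun v => √(‖χ v‖ ^ 2)) = fun v => ‖χ v‖ := by
    ext v; exact Real.sqrt_sq (norm_nonneg _)
  rw [h2, Real.sqrt_sq (norm_nonneg _)] at h1
  convert h1 using 1
  have := norm_ne_zero_iff.2 hu
  ext v
  simp
  field_simp

/-- Product rule; `l` is the derivative of the scaling factor `‖χ v‖ / ‖v‖` at `u`. -/
lemma hasFDerivAt_radialRescaling {A' : E →L[ℝ] F} {u : E} (hχ : HasFDerivAt χ A' u)
    (hu : u ≠ 0) (hχu : χ u ≠ 0) :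
    ∃ l : E →L[ℝ] ℝ, (∀ h, l h = ‖χ u‖⁻¹ * inner ℝ (χ u) (A' h) / ‖u‖ -
        ‖χ u‖ / ‖u‖ ^ 2 * (inner ℝ u h / ‖u‖)) ∧
      HasFDerivAt (radialRescaling χ)
        ((‖χ u‖ / ‖u‖) • ContinuousLinearMap.id ℝ E + l.smulRight u) u := by
  have hu' := norm_ne_zero_iff.2 hu
  have h1 := hasFDerivAt_norm_comp hχ hχu
  have h2 := hasFDerivAt_norm_comp (hasFDerivAt_id u) hu
  have h3 := h1.mul ((hasDerivAt_inv (show ‖id u‖ ≠ 0 from hu')).comp_hasFDerivAt u h2)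
  refine ⟨_, ?_, h3.smul (hasFDerivAt_id u)⟩
  intro h
  simp
  field_simp
  ring

/-- This bound tends to `0` with `u` when `χ` is `C¹` with isometric derivative `A` at `0`, which
gives continuity at `0` of the derivative of the rescaling. -/
lemma norm_fderiv_radialRescaling_sub_le {A' A : E →L[ℝ] F} {u : E} (hχ : HasFDerivAt χ A' u)
    (hu : u ≠ 0) (hχu : χ u ≠ 0) (hA : ∀ u, ‖A u‖ = ‖u‖) :
    ‖fderiv ℝ (radialRescaling χ) u - ContinuousLinearMap.id ℝ E‖ ≤
      ‖A' - A‖ + 4 * (‖χ u - A u‖ / ‖u‖) := by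
  obtain ⟨l, hl, hd⟩ := hasFDerivAt_radialRescaling hχ hu hχu
  have hu' : 0 < ‖u‖ := norm_pos_iff.2 hu
  have hχ' : 0 < ‖χ u‖ := norm_pos_iff.2 hχu
  set a := ‖χ u‖ / ‖u‖ with ha
  set e := ‖χ u - A u‖ / ‖u‖ with he
  have hae : |a - 1| ≤ e := by
    have : a - 1 = (‖χ u‖ - ‖A u‖) / ‖u‖ := by rw [hA, sub_div, div_self hu'.ne']
    rw [this, abs_div, abs_norm]
    exact div_le_div_of_nonneg_right (abs_norm_sub_norm_le _ _) hu'.le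
  have hAi : ∀ v w, inner ℝ (A v) (A w) = inner ℝ v w :=
    fun v w => LinearIsometry.inner_map_map (⟨A.toLinearMap, hA⟩ : E →ₗᵢ[ℝ] F) v w
  set ν := ‖χ u‖⁻¹ • χ u with hν
  have hν1 : ‖ν‖ = 1 := by rw [hν, norm_smul, norm_inv, norm_norm, inv_mul_cancel₀ hχ'.ne']
  -- Each of the three summands in the decomposition has norm at most `e`.
  have hνe : ‖ν - (a / ‖u‖) • A u‖ ≤ 3 * e := by
    have h1 : ν - (a / ‖u‖) • A u =
        (1 - a) • ν + ‖u‖⁻¹ • (χ u - A u) + ((1 - a) / ‖u‖) • A u := by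
      have h2 : a • ν = ‖u‖⁻¹ • χ u := by
        rw [hν, smul_smul, ha]; congr 1; field_simp
      rw [sub_smul, h2, sub_div, sub_smul, one_div, smul_sub, one_smul]
      abel
    rw [h1]
    refine (norm_add₃_le).trans ?_
    rw [norm_smul, hν1, norm_smul, norm_smul, hA, norm_div, norm_inv, norm_norm,
      div_mul_cancel₀ _ hu'.ne', Real.norm_eq_abs, abs_sub_comm, inv_mul_eq_div, ← he]
    linarith
  rw [hd.fderiv]
  refine ContinuousLinearMap.opNorm_le_bound _ (by positivity) fun h => ?_
  have h1 : (a • ContinuousLinearMap.id ℝ E + l.smulRight u - ContinuousLinearMap.id ℝ E) h =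
      (a - 1) • h + l h • u := by
    simp [sub_smul]; abel
  -- The isometry replaces `inner u h` by `inner (A u) (A h)`, so that both terms of `l h` can be
  -- compared in the target space.
  have h2 : l h * ‖u‖ = inner ℝ ν ((A' - A) h) + inner ℝ (ν - (a / ‖u‖) • A u) (A h) := by
    rw [hl, sub_apply, inner_sub_left, inner_sub_right, inner_smul_left _ _ (a / ‖u‖), hAi,
      hν, inner_smul_left, inner_smul_left]
    simp only [conj_trivial, ha]
    field_simp
    ring
  have h3 : ‖l h • u‖ ≤ (‖A' - A‖ + 3 * e) * ‖h‖ := by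
    rw [norm_smul, ← norm_norm u, ← norm_mul, h2]
    refine (norm_add_le _ _).trans ?_
    rw [add_mul]
    refine add_le_add ((norm_inner_le_norm _ _).trans ?_) ((norm_inner_le_norm _ _).trans ?_)
    · rw [hν1, one_mul]; exact ContinuousLinearMap.le_opNorm _ _
    · rw [hA]; gcongr
  rw [h1]
  refine (norm_add_le _ _).trans ?_
  rw [norm_smul, Real.norm_eq_abs]
  nlinarith [norm_nonneg h]

lemma contDiffAt_radialRescaling {A : E →L[ℝ] F} (h0 : χ 0 = 0) (hχ : HasFDerivAt χ A 0)
    (hχ1 : ContDiffAt ℝ 1 χ 0) (hA : ∀ u, ‖A u‖ = ‖u‖) :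
    ContDiffAt ℝ 1 (radialRescaling χ) 0 := by
  -- A zero `u ≠ 0` of `χ` near `0` would give `‖u‖ = ‖A u‖ ≤ ‖u‖ / 2`.
  have hlow : ∀ᶠ u in 𝓝 (0 : E), u ≠ 0 → χ u ≠ 0 := by
    have := (hasFDerivAt_iff_isLittleO_nhds_zero.1 hχ).def (c := 1 / 2) (by norm_num)
    filter_upwards [this] with u hu hu0 hχu
    have hpos := norm_pos_iff.2 hu0
    simp only [zero_add, hχu, h0, sub_zero, zero_sub, norm_neg, hA] at hu
    linarith
  have hC : ∀ᶠ u in 𝓝 (0 : E), ContDiffAt ℝ 1 χ u := hχ1.eventually (by simp)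
  have hdiff : ∀ᶠ u in 𝓝 (0 : E), u ≠ 0 → ContDiffAt ℝ 1 (radialRescaling χ) u := by
    filter_upwards [hlow, hC] with u hu h1 hu0
    exact (((h1.norm ℝ (hu hu0)).div (contDiffAt_id.norm ℝ hu0) (norm_ne_zero_iff.2 hu0))).smul
      contDiffAt_id
  have hd0 := hasFDerivAt_radialRescaling_zero h0 hχ hA
  have hcont0 : ContinuousAt (fderiv ℝ (radialRescaling χ)) 0 := by
    rw [ContinuousAt, hd0.fderiv, tendsto_iff_norm_sub_tendsto_zero]
    have hb : Tendsto (fun u => ‖fderiv ℝ χ u - A‖ + 4 * (‖χ u - A u‖ / ‖u‖)) (𝓝 0) (𝓝 0) := by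
      have t1 : Tendsto (fun u => ‖fderiv ℝ χ u - A‖) (𝓝 0) (𝓝 0) := by
        rw [← tendsto_iff_norm_sub_tendsto_zero, ← hχ.fderiv]
        exact (hχ1.continuousAt_fderiv (by simp))
      have t2 : Tendsto (fun u => ‖χ u - A u‖ / ‖u‖) (𝓝 0) (𝓝 0) := by
        have := (hasFDerivAt_iff_isLittleO_nhds_zero.1 hχ).norm_norm.tendsto_div_nhds_zero
        simpa [h0] using this
      simpa using t1.add (t2.const_mul 4)
    refine squeeze_zero' (Eventually.of_forall fun _ => norm_nonneg _) ?_ hb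
    filter_upwards [hlow, hC] with u hu h1
    rcases eq_or_ne u 0 with rfl | hu0
    · rw [hd0.fderiv, sub_self, norm_zero]; positivity
    · exact norm_fderiv_radialRescaling_sub_le
        (h1.differentiableAt (by simp)).hasFDerivAt hu0 (hu hu0) hA
  rw [contDiffAt_one_iff]
  refine ⟨fderiv ℝ (radialRescaling χ), _, hdiff, fun u hu => ?_, fun u hu => ?_⟩
  · rcases eq_or_ne u 0 with rfl | hu0
    · exact hcont0.continuousWithinAt
    · exact ((hu hu0).continuousAt_fderiv (by simp)).continuousWithinAt
  · rcases eq_or_ne u 0 with rfl | hu0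
    · rw [hd0.fderiv]; exact hd0
    · exact ((hu hu0).differentiableAt (by simp)).hasFDerivAt

end radialRescaling

/-! ### Charts preserving the distance to the centre -/

/-- Every injective linear map becomes isometric after a linear change of coordinates. -/
lemma exists_continuousLinearEquiv_norm_eq {d D : ℕ}
    {A : EuclideanSpace ℝ (Fin d) →L[ℝ] EuclideanSpace ℝ (Fin D)} (hA : Function.Injective A) :
    ∃ B : EuclideanSpace ℝ (Fin d) ≃L[ℝ] EuclideanSpace ℝ (Fin d), ∀ u, ‖B u‖ = ‖A u‖ := by
  have hr : Module.finrank ℝ (LinearMap.range A.toLinearMap) = d := by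
    rw [LinearMap.finrank_range_of_inj hA, finrank_euclideanSpace_fin]
  let b := ((stdOrthonormalBasis ℝ (LinearMap.range A.toLinearMap)).reindex (finCongr hr)).repr
  refine ⟨((LinearEquiv.ofInjective A.toLinearMap hA).trans b.toLinearEquiv).toContinuousLinearEquiv,
    fun u => ?_⟩
  have : ‖b (LinearEquiv.ofInjective A.toLinearMap hA u)‖ = ‖A u‖ := by
    rw [b.norm_map]; rfl
  exact this

namespace LocalParametrization
variable {D d : ℕ} {M : Set (EuclideanSpace ℝ (Fin D))} (P : LocalParametrization M d)

lemma riemannianMeasure_inter_ball (hM : IsEmbeddedSubmanifold M d)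
    {x : EuclideanSpace ℝ (Fin D)} {ε : ℝ} (hε : M ∩ Metric.ball x ε ⊆ P.toFun '' P.U)
    {T : Set (EuclideanSpace ℝ (Fin D))} (hT : MeasurableSet T) :
    riemannianMeasure M d (T ∩ Metric.ball x ε) = P.patchMeasure (T ∩ Metric.ball x ε) := by
  rw [← P.riemannianMeasure_restrict_image,
    Measure.restrict_apply (hT.inter Metric.isOpen_ball.measurableSet)]
  refine measure_congr ?_
  filter_upwards [hM.ae_mem] with y hy
  have : y ∈ T ∩ Metric.ball x ε ↔ y ∈ T ∩ Metric.ball x ε ∩ P.toFun '' P.U :=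
    ⟨fun h => ⟨h, hε ⟨hy, h.2⟩⟩, fun h => h.1⟩
  exact propext this

/-- A `C¹` reparametrization in which the distance to `x` is the norm of the parameter. -/
lemma exists_radial_reparametrization {x : EuclideanSpace ℝ (Fin D)} (hx : x ∈ P.toFun '' P.U) :
    ∃ ε > 0, ∃ τ : EuclideanSpace ℝ (Fin d) → EuclideanSpace ℝ (Fin d),
      (∀ v ∈ Metric.ball 0 ε, τ v ∈ P.U ∧ ContDiffAt ℝ 1 τ v ∧ ‖P.toFun (τ v) - x‖ = ‖v‖) ∧
      InjOn τ (Metric.ball 0 ε) ∧ P.toFun (τ 0) = x ∧ Function.Injective (fderiv ℝ τ 0) ∧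
      ∀ y ∈ M ∩ Metric.ball x ε, ∃ v ∈ Metric.ball 0 ε, P.toFun (τ v) = y := by
  obtain ⟨u₀, hu₀, rfl⟩ := hx
  set A := fderiv ℝ P.toFun u₀ with hAdef
  -- Precomposition with `B.symm` makes the derivative at the centre isometric, as the radial
  -- rescaling requires.
  obtain ⟨B, hB⟩ := exists_continuousLinearEquiv_norm_eq (P.immersion u₀ hu₀)
  set α : EuclideanSpace ℝ (Fin d) → EuclideanSpace ℝ (Fin d) := fun u => u₀ + B.symm u with hα
  have hα0 : α 0 = u₀ := by simp [hα]
  have hαc : ContDiff ℝ 1 α := contDiff_const.add B.symm.contDiff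
  have hαd : ∀ u, HasFDerivAt α (B.symm : EuclideanSpace ℝ (Fin d) →L[ℝ] _) u :=
    fun u => (B.symm.hasFDerivAt).const_add u₀
  have hαi : Function.Injective α := fun a b h => by simpa [hα] using h
  set χ : EuclideanSpace ℝ (Fin d) → EuclideanSpace ℝ (Fin D) :=
    fun u => P.toFun (α u) - P.toFun u₀ with hχ
  have h0 : χ 0 = 0 := by simp [hχ, hα0]
  have hχd : HasFDerivAt χ (A.comp (B.symm : EuclideanSpace ℝ (Fin d) →L[ℝ] _)) 0 := by
    have h1 : HasFDerivAt P.toFun A (α 0) := by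
      rw [hα0]; exact (P.hasStrictFDerivAt hu₀).hasFDerivAt
    exact (h1.comp 0 (hαd 0)).sub_const _
  have hχ1 : ContDiffAt ℝ 1 χ 0 := by
    have h1 : ContDiffAt ℝ 1 P.toFun (α 0) := by
      rw [hα0]
      exact (P.smooth.contDiffAt (P.isOpen_U.mem_nhds hu₀)).of_le (by simp)
    exact (h1.comp 0 hαc.contDiffAt).sub contDiffAt_const
  have hiso : ∀ u, ‖A.comp (B.symm : EuclideanSpace ℝ (Fin d) →L[ℝ] _) u‖ = ‖u‖ := fun u => by
    have := hB (B.symm u)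
    simpa using this.symm
  have hΨ := contDiffAt_radialRescaling h0 hχd hχ1 hiso
  have hΨd : HasFDerivAt (radialRescaling χ)
      ((ContinuousLinearEquiv.refl ℝ (EuclideanSpace ℝ (Fin d)) :
        EuclideanSpace ℝ (Fin d) ≃L[ℝ] EuclideanSpace ℝ (Fin d)) :
        EuclideanSpace ℝ (Fin d) →L[ℝ] EuclideanSpace ℝ (Fin d)) 0 :=
    hasFDerivAt_radialRescaling_zero h0 hχd hiso
  have hΨ0 : radialRescaling χ 0 = 0 := by simp [radialRescaling]
  -- The rescaling has derivative the identity at `0`; its local inverse `e.symm` turns `‖χ u‖` into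
  -- the norm of the new parameter.
  set e := hΨ.toOpenPartialHomeomorph (radialRescaling χ) hΨd one_ne_zero with he
  have hecoe : ∀ u, e u = radialRescaling χ u := fun u => rfl
  have h0s : (0 : EuclideanSpace ℝ (Fin d)) ∈ e.source :=
    hΨ.mem_toOpenPartialHomeomorph_source hΨd one_ne_zero
  have h0t : (0 : EuclideanSpace ℝ (Fin d)) ∈ e.target := by
    have := hΨ.image_mem_toOpenPartialHomeomorph_target hΨd one_ne_zero
    rwa [hΨ0] at this
  have hes0 : e.symm 0 = 0 := by
    have := e.left_inv h0s
    rwa [hecoe, hΨ0] at this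
  have hsC : ContDiffAt ℝ 1 e.symm 0 := by
    refine e.contDiffAt_symm h0t (f₀' := ContinuousLinearEquiv.refl ℝ _) ?_ ?_
    · rw [hes0]; exact hΨd
    · rw [hes0]; exact hΨ
  have hsd : HasFDerivAt e.symm (ContinuousLinearMap.id ℝ (EuclideanSpace ℝ (Fin d))) 0 := by
    have := e.hasFDerivAt_symm (f' := ContinuousLinearEquiv.refl ℝ _) h0t
      (by rw [hes0]; exact hΨd)
    exact this
  have hev1 : ∀ᶠ v in 𝓝 (0 : EuclideanSpace ℝ (Fin d)),
      v ∈ e.target ∧ ContDiffAt ℝ 1 e.symm v ∧ α (e.symm v) ∈ P.U := by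
    refine (e.open_target.eventually_mem h0t).and ((hsC.eventually (by simp)).and ?_)
    refine (hαc.continuous.continuousAt.comp hsC.continuousAt).eventually_mem ?_
    simp only [Function.comp, hes0, hα0]
    exact P.isOpen_U.mem_nhds hu₀
  obtain ⟨ε₁, hε₁, hball⟩ := Metric.eventually_nhds_iff_ball.1 hev1
  -- The embedding property is used here: points of the patch close to the centre have parameters
  -- close to `u₀`.
  obtain ⟨ε₂, hε₂, hloc⟩ : ∃ ε₂ > 0, ∀ u ∈ P.U, dist (P.toFun u) (P.toFun u₀) < ε₂ →
      B (u - u₀) ∈ e.source := by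
    have h1 : ∀ᶠ u : P.U in 𝓝 ⟨u₀, hu₀⟩, B ((u : EuclideanSpace ℝ (Fin d)) - u₀) ∈ e.source := by
      have hc : Continuous fun u : P.U => B ((u : EuclideanSpace ℝ (Fin d)) - u₀) := by fun_prop
      refine hc.continuousAt.eventually_mem ?_
      simpa using e.open_source.mem_nhds h0s
    rw [P.embedding.nhds_eq_comap, eventually_comap, Metric.eventually_nhds_iff] at h1
    obtain ⟨ε, hε, h⟩ := h1
    exact ⟨ε, hε, fun u hu hd => h hd ⟨u, hu⟩ rfl⟩
  obtain ⟨V, hV, hVe⟩ := P.isOpen_image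
  have hxV : P.toFun u₀ ∈ M ∩ V := hVe ▸ ⟨u₀, hu₀, rfl⟩
  obtain ⟨ε₃, hε₃, hV3⟩ := Metric.isOpen_iff.1 hV _ hxV.2
  -- Below `ε₁` the inverse is `C¹` with values over `P.U`, below `ε₂` the parameters lie in its
  -- range, and below `ε₃` the points of `M` lie in the patch.
  refine ⟨min ε₁ (min ε₂ ε₃), lt_min hε₁ (lt_min hε₂ hε₃), fun v => α (e.symm v), ?_, ?_, ?_, ?_, ?_⟩
  · intro v hv
    obtain ⟨ht, hC, hU⟩ := hball v (Metric.ball_subset_ball (min_le_left _ _) hv)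
    refine ⟨hU, hαc.contDiffAt.comp v hC, ?_⟩
    calc ‖P.toFun (α (e.symm v)) - P.toFun u₀‖ = ‖radialRescaling χ (e.symm v)‖ :=
          (norm_radialRescaling h0 _).symm
      _ = ‖v‖ := by rw [← hecoe, e.right_inv ht]
  · intro v hv w hw h
    have hv' := (hball v (Metric.ball_subset_ball (min_le_left _ _) hv)).1
    have hw' := (hball w (Metric.ball_subset_ball (min_le_left _ _) hw)).1
    exact e.symm.injOn hv' hw' (hαi h)
  · simp only [hes0, hα0]
  · have h1 : HasFDerivAt (fun v => α (e.symm v))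
        ((B.symm : EuclideanSpace ℝ (Fin d) →L[ℝ] _).comp (ContinuousLinearMap.id ℝ _)) 0 :=
      (hαd _).comp 0 hsd
    rw [h1.fderiv]
    exact B.symm.injective
  · rintro y ⟨hyM, hy⟩
    have hyV : y ∈ M ∩ V :=
      ⟨hyM, hV3 (Metric.ball_subset_ball ((min_le_right _ _).trans (min_le_right _ _)) hy)⟩
    rw [← hVe] at hyV
    obtain ⟨u, hu, rfl⟩ := hyV
    have hus := hloc u hu
      (Metric.ball_subset_ball ((min_le_right _ _).trans (min_le_left _ _)) hy)
    have hαu : α (B (u - u₀)) = u := by simp [hα]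
    refine ⟨e (B (u - u₀)), ?_, ?_⟩
    · rw [mem_ball_zero_iff, hecoe, norm_radialRescaling h0]
      simp only [hχ, hαu]
      exact mem_ball_iff_norm.1 hy
    · simp only [e.left_inv hus, hαu]

end LocalParametrization

/-- Near one of its points `x`, the Riemannian measure of a submanifold is the image of a measure
with continuous density under a map which preserves the distance to the centre. -/
theorem IsEmbeddedSubmanifold.exists_radial_chart {D d : ℕ} {M : Set (EuclideanSpace ℝ (Fin D))}
    (hM : IsEmbeddedSubmanifold M d) {x : EuclideanSpace ℝ (Fin D)} (hx : x ∈ M) :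
    ∃ ε > 0, ∃ κ : EuclideanSpace ℝ (Fin d) → EuclideanSpace ℝ (Fin D),
      ∃ h : EuclideanSpace ℝ (Fin d) → ℝ,
        ContinuousOn κ (Metric.ball 0 ε) ∧ ContinuousOn h (Metric.ball 0 ε) ∧
        (∀ v, 0 ≤ h v) ∧ 0 < h 0 ∧
        (∀ v ∈ Metric.ball 0 ε, κ v ∈ M ∧ ‖κ v - x‖ = ‖v‖) ∧
        (riemannianMeasure M d).restrict (Metric.ball x ε) =
          ((volume.restrict (Metric.ball 0 ε)).withDensity fun v => ENNReal.ofReal (h v)).map κ := by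
  obtain ⟨P, hP⟩ := hM x hx
  obtain ⟨ε, hε, τ, hτ, hinj, hτ0, hτ'0, hsurj⟩ := P.exists_radial_reparametrization hP
  have h0 : (0 : EuclideanSpace ℝ (Fin d)) ∈ Metric.ball 0 ε := Metric.mem_ball_self hε
  have hτc : ContinuousOn τ (Metric.ball 0 ε) := fun v hv =>
    (hτ v hv).2.1.continuousAt.continuousWithinAt
  have hκc : ContinuousOn (P.toFun ∘ τ) (Metric.ball 0 ε) :=
    P.continuousOn.comp hτc fun v hv => (hτ v hv).1
  have hbm : MeasurableSet (Metric.ball (0 : EuclideanSpace ℝ (Fin d)) ε) :=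
    Metric.isOpen_ball.measurableSet
  have hκM : ∀ v ∈ Metric.ball 0 ε, (P.toFun ∘ τ) v ∈ M ∧ ‖(P.toFun ∘ τ) v - x‖ = ‖v‖ :=
    fun v hv => ⟨P.image_subset ⟨τ v, (hτ v hv).1, rfl⟩, (hτ v hv).2.2⟩
  refine ⟨ε, hε, P.toFun ∘ τ,
    fun v => volumeFactor ((fderiv ℝ P.toFun (τ v)).comp (fderiv ℝ τ v)),
    hκc, ?_, fun v => Real.sqrt_nonneg _, ?_, hκM, ?_⟩
  · refine continuous_volumeFactor.comp_continuousOn (ContinuousOn.clm_comp ?_ ?_)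
    · exact (P.smooth.continuousOn_fderiv_of_isOpen P.isOpen_U (by simp)).comp hτc
        fun v hv => (hτ v hv).1
    · exact fun v hv => ((hτ v hv).2.1.continuousAt_fderiv (by simp)).continuousWithinAt
  · exact volumeFactor_pos ((P.immersion _ (hτ 0 h0).1).comp hτ'0)
  · ext T hT
    have hκm : AEMeasurable (P.toFun ∘ τ) (volume.restrict (Metric.ball 0 ε)) :=
      hκc.aemeasurable hbm
    rw [Measure.restrict_apply hT, P.riemannianMeasure_inter_ball hM ?_ hT,
      P.patchMeasure_apply (hT.inter Metric.isOpen_ball.measurableSet),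
      Measure.map_apply_of_aemeasurable
        (hκm.mono_ac (withDensity_absolutelyContinuous _ _)) hT, withDensity_apply',
      Measure.restrict_restrict' hbm, inter_comm (P.toFun ∘ τ ⁻¹' T),
      ← P.lintegral_image_volumeFactor (hκc.measurableSet_inter_preimage hbm hT)
        (fun v hv => ((hτ v hv.1).2.1.differentiableAt (by simp)).hasFDerivAt)
        (hinj.mono inter_subset_left)]
    -- Both domains of integration agree because `τ` matches the norm of the parameter with the
    -- distance to `x`.
    · congr 2
      ext u
      constructor
      · rintro ⟨hu, huT, hub⟩
        obtain ⟨v, hv, hvu⟩ := hsurj (P.toFun u) ⟨P.image_subset ⟨u, hu, rfl⟩, hub⟩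
        refine ⟨v, ⟨hv, ?_⟩, P.injOn (hτ v hv).1 hu hvu⟩
        simpa only [mem_preimage, Function.comp, hvu] using huT
      · rintro ⟨v, ⟨hv, hvT⟩, rfl⟩
        refine ⟨(hτ v hv).1, hvT, ?_⟩
        rw [mem_ball_iff_norm, (hτ v hv).2.2]
        exact mem_ball_zero_iff.1 hv
    · intro y hy
      obtain ⟨v, hv, hvu⟩ := hsurj y hy
      exact ⟨τ v, (hτ v hv).1, hvu⟩

/-! ### Integrals over balls in polar coordinates -/

/-- Tietze extension from the closed ball of radius `ε / 2`; it lets the polar-coordinate lemmas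
assume global continuity. -/
lemma ContinuousOn.exists_continuous_eqOn_ball {E : Type*} [NormedAddCommGroup E] {g : E → ℝ} {ε : ℝ}
    (hg : ContinuousOn g (Metric.ball 0 ε)) (hε : 0 < ε) :
    ∃ g' : E → ℝ, Continuous g' ∧ ∀ r ≤ ε / 2, EqOn g' g (Metric.ball 0 r) := by
  have hsub : Metric.closedBall (0 : E) (ε / 2) ⊆ Metric.ball 0 ε :=
    Metric.closedBall_subset_ball (by linarith)
  obtain ⟨G, hG⟩ := ContinuousMap.exists_restrict_eq
    (Metric.isClosed_closedBall (x := (0 : E)) (ε := ε / 2))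
    ⟨(Metric.closedBall (0 : E) (ε / 2)).domRestrict g,
      (hg.mono hsub).domRestrict⟩
  refine ⟨G, G.continuous, fun r hr v hv => ?_⟩
  have hv' : v ∈ Metric.closedBall (0 : E) (ε / 2) :=
    Metric.closedBall_subset_closedBall hr (Metric.ball_subset_closedBall hv)
  exact DFunLike.congr_fun hG ⟨v, hv'⟩

section Polar

variable {E : Type*} [NormedAddCommGroup E] [NormedSpace ℝ E] [MeasurableSpace E] [BorelSpace E]
  [FiniteDimensional ℝ E] (μ : Measure E) [μ.IsAddHaarMeasure]

/-- Integration in polar coordinates. -/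
lemma integral_eq_integral_Ioi_integral_sphere [Nontrivial E] {f : E → ℝ} (hf : Integrable f μ) :
    ∫ x, f x ∂μ = ∫ t in Ioi (0 : ℝ), t ^ (Module.finrank ℝ E - 1) *
      ∫ θ : Metric.sphere (0 : E) 1, f (t • (θ : E)) ∂μ.toSphere := by
  have hmp := μ.measurePreserving_homeomorphUnitSphereProd
  have hemb := Homeomorph.measurableEmbedding (homeomorphUnitSphereProd E)
  set F : Metric.sphere (0 : E) 1 × Ioi (0 : ℝ) → ℝ := fun z => f ((z.2 : ℝ) • (z.1 : E)) with hF
  have hFe : ∀ x : ({0}ᶜ : Set E), F (homeomorphUnitSphereProd E x) = f x := by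
    intro x
    have : ‖(x : E)‖ ≠ 0 := norm_ne_zero_iff.2 x.2
    simp [hF, smul_smul, this]
  have hint : Integrable F (μ.toSphere.prod (Measure.volumeIoiPow (Module.finrank ℝ E - 1))) := by
    rw [← hmp.integrable_comp_emb hemb]
    have h1 : IntegrableOn f {0}ᶜ μ := hf.integrableOn
    rw [integrableOn_iff_comap_subtypeVal (measurableSet_singleton _).compl] at h1
    exact h1.congr (Eventually.of_forall fun x => (hFe x).symm)
  calc ∫ x, f x ∂μ = ∫ x : ({(0)}ᶜ : Set E), f x ∂(μ.comap (↑)) := by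
        rw [integral_subtype_comap (measurableSet_singleton _).compl f, restrict_compl_singleton]
    _ = ∫ z, F z ∂μ.toSphere.prod (.volumeIoiPow (Module.finrank ℝ E - 1)) := by
        rw [← hmp.integral_comp hemb]
        exact integral_congr_ae (Eventually.of_forall fun x => (hFe x).symm)
    _ = ∫ t : Ioi (0 : ℝ), ∫ θ, F (θ, t) ∂μ.toSphere ∂.volumeIoiPow (Module.finrank ℝ E - 1) :=
        integral_prod_symm _ hint
    _ = _ := by
        simp only [Measure.volumeIoiPow, ENNReal.ofReal]
        rw [integral_withDensity_eq_integral_smul,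
          integral_subtype_comap measurableSet_Ioi fun a : ℝ =>
            Real.toNNReal (a ^ (Module.finrank ℝ E - 1)) •
              ∫ θ : Metric.sphere (0 : E) 1, f (a • (θ : E)) ∂μ.toSphere,
          setIntegral_congr_fun measurableSet_Ioi fun x hx ↦ ?_]
        · rw [NNReal.smul_def, Real.coe_toNNReal _ (pow_nonneg hx.out.le _), smul_eq_mul]
        · exact (measurable_subtype_coe.pow_const _).real_toNNReal

lemma integral_ball_eq_intervalIntegral [Nontrivial E] {g : E → ℝ} (hg : Continuous g) {r : ℝ}
    (hr : 0 ≤ r) :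
    ∫ v in Metric.ball 0 r, g v ∂μ = ∫ t in (0 : ℝ)..r, t ^ (Module.finrank ℝ E - 1) *
      ∫ θ : Metric.sphere (0 : E) 1, g (t • (θ : E)) ∂μ.toSphere := by
  have hb : MeasurableSet (Metric.ball (0 : E) r) := Metric.isOpen_ball.measurableSet
  have hint : Integrable ((Metric.ball (0 : E) r).indicator g) μ := by
    rw [integrable_indicator_iff hb]
    exact (hg.continuousOn.integrableOn_compact (isCompact_closedBall (0 : E) r)).mono_set
      Metric.ball_subset_closedBall
  rw [← integral_indicator hb, integral_eq_integral_Ioi_integral_sphere μ hint,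
    intervalIntegral.integral_of_le hr, ← restrict_Ioo_eq_restrict_Ioc,
    ← Ioi_inter_Iio, inter_comm, ← Measure.restrict_restrict measurableSet_Iio,
    ← integral_indicator measurableSet_Iio]
  refine setIntegral_congr_fun measurableSet_Ioi fun t (ht : 0 < t) => ?_
  have hn : ∀ θ : Metric.sphere (0 : E) 1, t • (θ : E) ∈ Metric.ball (0 : E) r ↔ t < r := by
    intro θ
    rw [mem_ball_zero_iff, norm_smul, norm_eq_of_mem_sphere, mul_one, Real.norm_of_nonneg ht.le]
  by_cases htr : t < r
  · simp [indicator, hn, htr]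
  · simp [indicator, hn, htr]

lemma continuous_integral_sphere {g : E → ℝ} (hg : Continuous g) :
    Continuous fun t : ℝ => ∫ θ : Metric.sphere (0 : E) 1, g (t • (θ : E)) ∂μ.toSphere := by
  have h : Continuous (Function.uncurry fun (t : ℝ) (θ : Metric.sphere (0 : E) 1) =>
      g (t • (θ : E))) := by
    unfold Function.uncurry
    fun_prop
  simpa using continuous_parametric_integral_of_continuous (μ := μ.toSphere) h isCompact_univ

lemma hasDerivAt_integral_ball [Nontrivial E] {g : E → ℝ} (hg : Continuous g) {r : ℝ}
    (hr : 0 < r) :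
    HasDerivAt (fun r => ∫ v in Metric.ball 0 r, g v ∂μ) (r ^ (Module.finrank ℝ E - 1) *
      ∫ θ : Metric.sphere (0 : E) 1, g (r • (θ : E)) ∂μ.toSphere) r := by
  have hc : Continuous fun t : ℝ => t ^ (Module.finrank ℝ E - 1) *
      ∫ θ : Metric.sphere (0 : E) 1, g (t • (θ : E)) ∂μ.toSphere :=
    (continuous_pow _).mul (continuous_integral_sphere μ hg)
  refine (hc.integral_hasStrictDerivAt 0 r).hasDerivAt.congr_of_eventuallyEq ?_
  filter_upwards [lt_mem_nhds hr] with s hs using integral_ball_eq_intervalIntegral μ hg hs.le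

/-- The integral of a continuous function over small balls around the origin. -/
lemma deriv_integral_ball {g : E → ℝ} (hg : Continuous g) :
    (∀ r > 0, DifferentiableAt ℝ (fun r => ∫ v in Metric.ball 0 r, g v ∂μ) r) ∧
    (0 < g 0 →
      (∀ᶠ r in 𝓝[>] (0 : ℝ), 0 < ∫ v in Metric.ball 0 r, g v ∂μ) ∧
      Tendsto (fun r => r * deriv (fun r => ∫ v in Metric.ball 0 r, g v ∂μ) r /
        ∫ v in Metric.ball 0 r, g v ∂μ) (𝓝[>] 0) (𝓝 (Module.finrank ℝ E))) := by
  -- In dimension `0` every ball of positive radius is the whole space, so the integral is constant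
  -- and the quotient is `0`.
  rcases subsingleton_or_nontrivial E with hE | hE
  · have hconst : ∀ r > 0, ∫ v in Metric.ball 0 r, g v ∂μ = μ.real univ * g 0 := by
      intro r hr
      have h1 : Metric.ball (0 : E) r = univ :=
        eq_univ_of_forall fun v => by rw [Subsingleton.elim v 0]; exact Metric.mem_ball_self hr
      have h2 : g = fun _ => g 0 := funext fun v => by rw [Subsingleton.elim v 0]
      rw [h1, Measure.restrict_univ, h2, integral_const, smul_eq_mul]
    have hd : ∀ r > 0, HasDerivAt (fun r => ∫ v in Metric.ball 0 r, g v ∂μ) 0 r := by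
      intro r hr
      refine (hasDerivAt_const r (μ.real univ * g 0)).congr_of_eventuallyEq ?_
      filter_upwards [lt_mem_nhds hr] with s hs using hconst s hs
    refine ⟨fun r hr => (hd r hr).differentiableAt, fun h0 => ⟨?_, ?_⟩⟩
    · filter_upwards [self_mem_nhdsWithin] with r hr
      rw [hconst r hr]
      refine mul_pos (ENNReal.toReal_pos (isOpen_univ.measure_ne_zero μ univ_nonempty) ?_) h0
      have : (univ : Set E) = {0} := eq_univ_of_forall (fun v => Subsingleton.elim v 0) |>.symm
      rw [this]
      exact isCompact_singleton.measure_lt_top.ne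
    · rw [Module.finrank_zero_of_subsingleton, Nat.cast_zero]
      refine tendsto_const_nhds.congr' ?_
      filter_upwards [self_mem_nhdsWithin] with r hr
      rw [(hd r hr).deriv, mul_zero, zero_div]
  · set n := Module.finrank ℝ E with hn
    have hn0 : 0 < n := Module.finrank_pos
    set S : ℝ → ℝ := fun t => ∫ θ : Metric.sphere (0 : E) 1, g (t • (θ : E)) ∂μ.toSphere with hS
    set K : ℝ → ℝ := fun r => ∫ v in Metric.ball 0 r, g v ∂μ with hK
    have hSc : Continuous S := continuous_integral_sphere μ hg
    have hKd : ∀ r > 0, HasDerivAt K (r ^ (n - 1) * S r) r :=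
      fun r hr => hasDerivAt_integral_ball μ hg hr
    refine ⟨fun r hr => (hKd r hr).differentiableAt, fun h0 => ?_⟩
    have hS0 : 0 < S 0 := by
      have : S 0 = μ.toSphere.real univ * g 0 := by simp [hS]
      rw [this]
      refine mul_pos (ENNReal.toReal_pos ?_ (measure_ne_top _ _)) h0
      rw [Ne, Measure.measure_univ_eq_zero]
      exact μ.toSphere_ne_zero
    have hn' : (n : ℝ) ≠ 0 := Nat.cast_ne_zero.2 hn0.ne'
    -- L'Hôpital: the quotient of the derivatives is `S r / n`.
    have hlim : Tendsto (fun r => K r / r ^ n) (𝓝[>] 0) (𝓝 (S 0 / n)) := by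
      refine HasDerivAt.lhopital_zero_nhdsGT (f' := fun r => r ^ (n - 1) * S r)
        (g' := fun r => n * r ^ (n - 1)) ?_ ?_ ?_ ?_ ?_ ?_
      · filter_upwards [self_mem_nhdsWithin] with r hr using hKd r hr
      · exact Eventually.of_forall fun r => hasDerivAt_pow n r
      · filter_upwards [self_mem_nhdsWithin] with r hr
        exact mul_ne_zero hn' (pow_ne_zero _ (ne_of_gt hr))
      · have hc : Continuous fun r : ℝ => ∫ t in (0 : ℝ)..r, t ^ (n - 1) * S t :=
          intervalIntegral.continuous_primitive
            (fun a b => ((continuous_pow _).mul hSc).intervalIntegrable a b) 0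
        have h1 := hc.tendsto 0
        rw [intervalIntegral.integral_same] at h1
        refine (h1.mono_left nhdsWithin_le_nhds).congr' ?_
        filter_upwards [self_mem_nhdsWithin] with r (hr : 0 < r)
        exact (integral_ball_eq_intervalIntegral μ hg hr.le).symm
      · have := (continuous_pow n (M := ℝ)).tendsto 0
        rw [zero_pow hn0.ne'] at this
        exact this.mono_left nhdsWithin_le_nhds
      · refine (((hSc.tendsto 0).mono_left nhdsWithin_le_nhds).div_const (n : ℝ)).congr' ?_
        filter_upwards [self_mem_nhdsWithin] with r hr
        have : r ^ (n - 1) ≠ 0 := pow_ne_zero _ (ne_of_gt hr)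
        field_simp
    have hpos : ∀ᶠ r in 𝓝[>] (0 : ℝ), 0 < K r := by
      filter_upwards [self_mem_nhdsWithin, hlim.eventually (lt_mem_nhds
        (div_pos hS0 (Nat.cast_pos.2 hn0)))] with r hr h
      exact (div_pos_iff_of_pos_right (pow_pos hr _)).1 h
    refine ⟨hpos, ?_⟩
    -- `r * K' r / K r` equals `S r / (K r / r ^ n)`, whose limit is `S 0 / (S 0 / n) = n`.
    have h2 := ((hSc.tendsto 0).mono_left (nhdsWithin_le_nhds (s := Ioi 0))).div hlim
      (div_ne_zero hS0.ne' hn')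
    rw [div_div_cancel₀ hS0.ne'] at h2
    refine h2.congr' ?_
    filter_upwards [self_mem_nhdsWithin, hpos] with r (hr : 0 < r) hKr
    rw [(hKd r hr).deriv]
    have : r ^ n = r * r ^ (n - 1) := (mul_pow_sub_one hn0.ne' r).symm
    have hr' : r ^ (n - 1) ≠ 0 := pow_ne_zero _ hr.ne'
    change S r / (K r / r ^ n) = r * (r ^ (n - 1) * S r) / K r
    rw [this]
    field_simp

lemma deriv_integral_ball_of_continuousOn {g : E → ℝ} {ε : ℝ} (hε : 0 < ε)
    (hg : ContinuousOn g (Metric.ball 0 ε)) {K : ℝ → ℝ}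
    (hK : ∀ r ∈ Ioo 0 ε, K r = ∫ v in Metric.ball 0 r, g v ∂μ) :
    (∀ᶠ r in 𝓝[>] (0 : ℝ), DifferentiableAt ℝ K r) ∧
    (0 < g 0 → (∀ᶠ r in 𝓝[>] (0 : ℝ), 0 < K r) ∧
      Tendsto (fun r => r * deriv K r / K r) (𝓝[>] 0) (𝓝 (Module.finrank ℝ E))) := by
  obtain ⟨g', hg', heq⟩ := hg.exists_continuous_eqOn_ball hε
  have hKe : ∀ r ∈ Ioo 0 (ε / 2), K r = ∫ v in Metric.ball 0 r, g' v ∂μ := fun r hr => by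
    rw [hK r ⟨hr.1, hr.2.trans (by linarith)⟩]
    exact (setIntegral_congr_fun Metric.isOpen_ball.measurableSet (heq r hr.2.le)).symm
  have hmem : Ioo 0 (ε / 2) ∈ 𝓝[>] (0 : ℝ) := Ioo_mem_nhdsGT (by linarith)
  have hev : ∀ r ∈ Ioo 0 (ε / 2), K =ᶠ[𝓝 r] fun r => ∫ v in Metric.ball 0 r, g' v ∂μ :=
    fun r hr => by filter_upwards [isOpen_Ioo.mem_nhds hr] with s hs using hKe s hs
  have h0 : g' 0 = g 0 := heq (ε / 2) le_rfl (Metric.mem_ball_self (by linarith))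
  obtain ⟨h1, h2⟩ := deriv_integral_ball μ hg'
  refine ⟨?_, fun hpos => ?_⟩
  · filter_upwards [hmem] with r hr using (h1 r hr.1).congr_of_eventuallyEq (hev r hr)
  · obtain ⟨h3, h4⟩ := h2 (h0 ▸ hpos)
    refine ⟨?_, h4.congr' ?_⟩
    · filter_upwards [hmem, h3] with r hr h using hKe r hr ▸ h
    · filter_upwards [hmem] with r hr
      rw [(hev r hr).deriv_eq, hKe r hr]

end Polar

/-! ### Small balls on a submanifold -/

/-- Integrals of functions continuous near `x ∈ M` over small balls around `x`. -/
lemma IsEmbeddedSubmanifold.deriv_setIntegral_ball {D d : ℕ}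
    {M : Set (EuclideanSpace ℝ (Fin D))} (hM : IsEmbeddedSubmanifold M d)
    {x : EuclideanSpace ℝ (Fin D)} (hx : x ∈ M) {f : EuclideanSpace ℝ (Fin D) → ℝ}
    {V : Set (EuclideanSpace ℝ (Fin D))} (hV : V ∈ 𝓝 x) (hf : ContinuousOn f (M ∩ V)) :
    (∀ᶠ r in 𝓝[>] (0 : ℝ), DifferentiableAt ℝ
      (fun r => ∫ y in Metric.ball x r, f y ∂(riemannianMeasure M d)) r) ∧
    (0 < f x →
      (∀ᶠ r in 𝓝[>] (0 : ℝ), 0 < ∫ y in Metric.ball x r, f y ∂(riemannianMeasure M d)) ∧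
      Tendsto (fun r => r *
        deriv (fun r => ∫ y in Metric.ball x r, f y ∂(riemannianMeasure M d)) r /
          ∫ y in Metric.ball x r, f y ∂(riemannianMeasure M d)) (𝓝[>] 0) (𝓝 d)) := by
  obtain ⟨ε₁, hε₁, κ, h, hκ, hh, hh0, hhpos, hκM, hμ⟩ := hM.exists_radial_chart hx
  obtain ⟨ε₂, hε₂, hball⟩ := Metric.mem_nhds_iff.1 hV
  set μ := riemannianMeasure M d with hμdef
  have hε : 0 < min ε₁ ε₂ := lt_min hε₁ hε₂
  have hsub1 : Metric.ball (0 : EuclideanSpace ℝ (Fin d)) (min ε₁ ε₂) ⊆ Metric.ball 0 ε₁ :=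
    Metric.ball_subset_ball (min_le_left _ _)
  have hκV : ∀ v ∈ Metric.ball (0 : EuclideanSpace ℝ (Fin d)) (min ε₁ ε₂), κ v ∈ M ∩ V := by
    intro v hv
    refine ⟨(hκM v (hsub1 hv)).1, hball ?_⟩
    rw [mem_ball_iff_norm, (hκM v (hsub1 hv)).2]
    exact (mem_ball_zero_iff.1 hv).trans_le (min_le_right _ _)
  have hκ0 : κ 0 = x := by
    have := (hκM 0 (Metric.mem_ball_self hε₁)).2
    rwa [norm_zero, norm_sub_eq_zero_iff] at this
  have hg : ContinuousOn (fun v => h v * f (κ v)) (Metric.ball 0 (min ε₁ ε₂)) :=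
    (hh.mono hsub1).mul (hf.comp (hκ.mono hsub1) hκV)
  have hK : ∀ r ∈ Ioo 0 (min ε₁ ε₂),
      ∫ y in Metric.ball x r, f y ∂μ = ∫ v in Metric.ball 0 r, h v * f (κ v) := by
    intro r hr
    have hbx : MeasurableSet (Metric.ball x r) := Metric.isOpen_ball.measurableSet
    have hb0 : MeasurableSet (Metric.ball (0 : EuclideanSpace ℝ (Fin d)) ε₁) :=
      Metric.isOpen_ball.measurableSet
    have hbr : MeasurableSet (Metric.ball (0 : EuclideanSpace ℝ (Fin d)) r) :=
      Metric.isOpen_ball.measurableSet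
    have hrε : r ≤ ε₁ := hr.2.le.trans (min_le_left _ _)
    -- Continuity of `f` is known only along `M`, so the ball is first cut down to `M`, which
    -- carries the measure.
    have hfm : AEStronglyMeasurable f (μ.restrict (Metric.ball x r)) := by
      have h1 : μ.restrict (Metric.ball x r) = μ.restrict (M ∩ Metric.ball x r) := by
        refine Measure.restrict_congr_set ?_
        filter_upwards [hM.ae_mem] with y hy
        exact propext ⟨fun h => ⟨hy, h⟩, fun h => h.2⟩
      rw [h1]
      refine ContinuousOn.aestronglyMeasurable (hf.mono ?_) (hM.measurableSet.inter hbx)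
      exact inter_subset_inter_right _
        ((Metric.ball_subset_ball (hr.2.le.trans (min_le_right _ _))).trans hball)
    have hfi : AEStronglyMeasurable ((Metric.ball x r).indicator f)
        (μ.restrict (Metric.ball x ε₁)) := by
      rw [aestronglyMeasurable_indicator_iff hbx, Measure.restrict_restrict hbx,
        inter_eq_left.2 (Metric.ball_subset_ball hrε)]
      exact hfm
    calc ∫ y in Metric.ball x r, f y ∂μ
        = ∫ y in Metric.ball x ε₁, (Metric.ball x r).indicator f y ∂μ := by
          rw [integral_indicator hbx, Measure.restrict_restrict hbx,
            inter_eq_left.2 (Metric.ball_subset_ball hrε)]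
      _ = ∫ v in Metric.ball 0 ε₁, h v * (Metric.ball x r).indicator f (κ v) := by
          rw [hμ] at hfi ⊢
          rw [integral_map ((hκ.aemeasurable hb0).mono_ac (withDensity_absolutelyContinuous _ _))
            hfi, integral_withDensity_eq_integral_toReal_smul₀
              (hh.aemeasurable hb0).ennreal_ofReal (ae_of_all _ fun v => ENNReal.ofReal_lt_top)]
          simp only [ENNReal.toReal_ofReal (hh0 _), smul_eq_mul]
      _ = ∫ v in Metric.ball 0 ε₁, (Metric.ball 0 r).indicator (fun v => h v * f (κ v)) v := by
          refine setIntegral_congr_fun hb0 fun v hv => ?_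
          -- The radial chart pulls balls about `x` back to balls about `0`; an arbitrary chart
          -- would not.
          have hiff : κ v ∈ Metric.ball x r ↔ v ∈ Metric.ball 0 r := by
            rw [mem_ball_iff_norm, (hκM v hv).2, mem_ball_zero_iff]
          by_cases hv' : v ∈ Metric.ball 0 r
          · simp only [indicator_of_mem (hiff.2 hv'), indicator_of_mem hv']
          · simp only [indicator_of_notMem (mt hiff.1 hv'), indicator_of_notMem hv', mul_zero]
      _ = ∫ v in Metric.ball 0 r, h v * f (κ v) := by
          rw [integral_indicator hbr, Measure.restrict_restrict hbr,
            inter_eq_left.2 (Metric.ball_subset_ball hrε)]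
  have key := deriv_integral_ball_of_continuousOn volume hε hg hK
  rw [finrank_euclideanSpace_fin, hκ0] at key
  exact ⟨key.1, fun hpos => key.2 (mul_pos hhpos hpos)⟩

/-! ### Comparison of logarithmic derivatives -/

/-- If `F` is asymptotic to `c * G` in the strong sense that the increments are comparable, then
the logarithmic derivative of `F` has the same limit as that of `G`. -/
lemma tendsto_logDeriv_of_comparable {F G : ℝ → ℝ} {c m : ℝ} (hc : 0 < c)
    (hcomp : ∀ η > 0, ∃ ε > 0, MonotoneOn (fun r => F r - (c - η) * G r) (Ioo 0 ε) ∧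
      MonotoneOn (fun r => (c + η) * G r - F r) (Ioo 0 ε) ∧
      ∀ r ∈ Ioo 0 ε, |F r - c * G r| ≤ η * G r)
    (hGpos : ∀ᶠ r in 𝓝[>] (0 : ℝ), 0 < G r)
    (hGd : ∀ᶠ r in 𝓝[>] (0 : ℝ), DifferentiableAt ℝ G r)
    (hG : Tendsto (fun r => r * deriv G r / G r) (𝓝[>] 0) (𝓝 m)) :
    Tendsto (fun r => r * deriv F r / F r)
      (𝓝[>] 0 ⊓ 𝓟 {r | DifferentiableAt ℝ F r}) (𝓝 m) := by
  set l := 𝓝[>] (0 : ℝ) ⊓ 𝓟 {r | DifferentiableAt ℝ F r} with hl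
  have hle : l ≤ 𝓝[>] (0 : ℝ) := inf_le_left
  have hlF : ∀ᶠ r in l, DifferentiableAt ℝ F r := mem_inf_of_right (mem_principal_self _)
  have hFG : Tendsto (fun r => F r / G r) l (𝓝 c) := by
    refine Tendsto.mono_left ?_ hle
    rw [Metric.tendsto_nhds]
    intro η hη
    obtain ⟨ε, hε, -, -, h⟩ := hcomp (η / 2) (by linarith)
    filter_upwards [Ioo_mem_nhdsGT hε, hGpos] with r hr hGr
    have : F r / G r - c = (F r - c * G r) / G r := by field_simp
    rw [Real.dist_eq, this, abs_div, abs_of_pos hGr, div_lt_iff₀ hGr]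
    exact (h r hr).trans_lt (by nlinarith)
  have hd : Tendsto (fun r => r * deriv F r / G r) l (𝓝 (c * m)) := by
    have h1 : Tendsto (fun r => c * (r * deriv G r / G r)) l (𝓝 (c * m)) :=
      (hG.mono_left hle).const_mul c
    refine h1.congr_dist ?_
    rw [Metric.tendsto_nhds]
    intro e he
    have hm : 0 < |m| + 2 := by positivity
    -- The error will be `η * (r * G' / G)`, and `r * G' / G` is eventually below `|m| + 1`; hence
    -- `η = e / (|m| + 2)` keeps it below `e`.
    obtain ⟨ε, hε, hm1, hm2, -⟩ := hcomp (e / (|m| + 2)) (by positivity)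
    set η := e / (|m| + 2) with hη
    have hη0 : 0 < η := by positivity
    have hub : ∀ᶠ r in l, r * deriv G r / G r < |m| + 1 :=
      (hG.mono_left hle).eventually (gt_mem_nhds (by linarith [le_abs_self m]))
    filter_upwards [hle (Ioo_mem_nhdsGT hε), hle hGpos, hle hGd, hlF, hub] with r hr hGr hGr' hFr hu
    have hn := isOpen_Ioo.mem_nhds hr
    have e1 : 0 ≤ deriv F r - (c - η) * deriv G r := by
      have hder := hFr.hasDerivAt.sub (hGr'.hasDerivAt.const_mul (c - η))
      have := hm1.derivWithin_nonneg (x := r)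
      rw [derivWithin_of_mem_nhds hn] at this
      rwa [← hder.deriv]
    have e2 : 0 ≤ (c + η) * deriv G r - deriv F r := by
      have hder := (hGr'.hasDerivAt.const_mul (c + η)).sub hFr.hasDerivAt
      have := hm2.derivWithin_nonneg (x := r)
      rw [derivWithin_of_mem_nhds hn] at this
      rwa [← hder.deriv]
    have e3 : |c * deriv G r - deriv F r| ≤ η * deriv G r :=
      abs_le.2 ⟨by linarith, by linarith⟩
    rw [dist_zero_right, Real.norm_of_nonneg dist_nonneg, Real.dist_eq]
    have e4 : c * (r * deriv G r / G r) - r * deriv F r / G r =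
        r / G r * (c * deriv G r - deriv F r) := by ring
    have hrG : 0 < r / G r := div_pos hr.1 hGr
    rw [e4, abs_mul, abs_of_pos hrG]
    calc r / G r * |c * deriv G r - deriv F r| ≤ r / G r * (η * deriv G r) := by gcongr
      _ = η * (r * deriv G r / G r) := by ring
      _ < η * (|m| + 2) := mul_lt_mul_of_pos_left (by linarith) hη0
      _ = e := by rw [hη]; field_simp
  have := hd.div hFG hc.ne'
  rw [mul_div_cancel_left₀ _ hc.ne'] at this
  refine this.congr' ?_
  filter_upwards [hle hGpos] with r hGr
  simp only [Pi.div_apply]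
  rw [div_div_div_cancel_right₀ hGr.ne']

/-- The integrals of `f` over small balls are comparable with the volumes of these balls if `f` is
continuous at the centre. -/
lemma IsEmbeddedSubmanifold.setIntegral_ball_comparable {D d : ℕ}
    {M : Set (EuclideanSpace ℝ (Fin D))} (hM : IsEmbeddedSubmanifold M d)
    {x : EuclideanSpace ℝ (Fin D)} {f : EuclideanSpace ℝ (Fin D) → ℝ}
    (hf : Integrable f (riemannianMeasure M d)) (hc : ContinuousWithinAt f M x) (hpos : 0 < f x)
    {η : ℝ} (hη : 0 < η) :
    ∃ ε > 0,
      MonotoneOn (fun r => ∫ y in Metric.ball x r, f y ∂(riemannianMeasure M d) -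
        (f x - η) * ∫ _ in Metric.ball x r, (1 : ℝ) ∂(riemannianMeasure M d)) (Ioo 0 ε) ∧
      MonotoneOn (fun r => (f x + η) * ∫ _ in Metric.ball x r, (1 : ℝ) ∂(riemannianMeasure M d) -
        ∫ y in Metric.ball x r, f y ∂(riemannianMeasure M d)) (Ioo 0 ε) ∧
      ∀ r ∈ Ioo 0 ε, |∫ y in Metric.ball x r, f y ∂(riemannianMeasure M d) -
        f x * ∫ _ in Metric.ball x r, (1 : ℝ) ∂(riemannianMeasure M d)| ≤
          η * ∫ _ in Metric.ball x r, (1 : ℝ) ∂(riemannianMeasure M d) := by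
  set μ := riemannianMeasure M d with hμ
  -- The bound `η` gives the comparison. The bound `f x / 2` keeps `f` above `f x / 2` on the ball,
  -- so integrability of `f` forces the ball to have finite measure.
  obtain ⟨ε, hε, hclose⟩ := Metric.continuousWithinAt_iff.1 hc (min η (f x / 2)) (by positivity)
  have hb : ∀ r, MeasurableSet (Metric.ball x r) := fun r => Metric.isOpen_ball.measurableSet
  have hae : ∀ᵐ y ∂(μ.restrict (Metric.ball x ε)), |f y - f x| < min η (f x / 2) := by
    filter_upwards [ae_restrict_mem (hb ε), ae_restrict_of_ae hM.ae_mem] with y hy hyM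
    exact hclose hyM hy
  have hconst : IntegrableOn (fun _ => f x / 2) (Metric.ball x ε) μ := by
    refine Integrable.mono' hf.integrableOn aestronglyMeasurable_const ?_
    filter_upwards [hae] with y hy
    have := (abs_lt.1 (hy.trans_le (min_le_right _ _))).1
    rw [Real.norm_of_nonneg (by positivity)]
    linarith
  have hone : IntegrableOn (fun _ => (1 : ℝ)) (Metric.ball x ε) μ := by
    have := hconst.const_mul (f x / 2)⁻¹
    refine this.congr (ae_of_all _ fun y => ?_)
    have : f x / 2 ≠ 0 := by positivity
    simp only [inv_mul_cancel₀ this]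
  have hlow : 0 ≤ᵐ[μ.restrict (Metric.ball x ε)] fun y => f y - (f x - η) * 1 := by
    filter_upwards [hae] with y hy
    have := (abs_lt.1 (hy.trans_le (min_le_left _ _))).1
    simp only [Pi.zero_apply]
    linarith
  have hupp : 0 ≤ᵐ[μ.restrict (Metric.ball x ε)] fun y => (f x + η) * 1 - f y := by
    filter_upwards [hae] with y hy
    have := (abs_lt.1 (hy.trans_le (min_le_left _ _))).2
    simp only [Pi.zero_apply]
    linarith
  have hsub : ∀ {r}, r ≤ ε → Metric.ball x r ⊆ Metric.ball x ε := fun h => Metric.ball_subset_ball h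
  have hlowI : ∀ r ≤ ε, ∫ y in Metric.ball x r, f y ∂μ -
      (f x - η) * ∫ _ in Metric.ball x r, (1 : ℝ) ∂μ =
        ∫ y in Metric.ball x r, (f y - (f x - η) * 1) ∂μ := fun r hr => by
    rw [integral_sub hf.integrableOn ((hone.mono_set (hsub hr)).const_mul _), integral_const_mul]
  have huppI : ∀ r ≤ ε, (f x + η) * ∫ _ in Metric.ball x r, (1 : ℝ) ∂μ -
      ∫ y in Metric.ball x r, f y ∂μ =
        ∫ y in Metric.ball x r, ((f x + η) * 1 - f y) ∂μ := fun r hr => by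
    rw [integral_sub ((hone.mono_set (hsub hr)).const_mul _) hf.integrableOn, integral_const_mul]
  -- Both monotonicity claims reduce to this: a nonnegative function has integrals increasing with
  -- the ball.
  have hmono : ∀ g : EuclideanSpace ℝ (Fin D) → ℝ, IntegrableOn g (Metric.ball x ε) μ →
      0 ≤ᵐ[μ.restrict (Metric.ball x ε)] g →
      ∀ r s, r ≤ s → s ≤ ε → ∫ y in Metric.ball x r, g y ∂μ ≤ ∫ y in Metric.ball x s, g y ∂μ :=
    fun g hg h0 r s hrs hs => setIntegral_mono_set (hg.mono_set (hsub hs))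
      (ae_restrict_of_ae_restrict_of_subset (hsub hs) h0)
      (Metric.ball_subset_ball hrs).eventuallyLE
  refine ⟨ε, hε, ?_, ?_, ?_⟩
  · intro r hr s hs hrs
    simp only [hlowI r hr.2.le, hlowI s hs.2.le]
    exact hmono _ (hf.integrableOn.sub (hone.const_mul _)) hlow r s hrs hs.2.le
  · intro r hr s hs hrs
    simp only [huppI r hr.2.le, huppI s hs.2.le]
    exact hmono _ ((hone.const_mul _).sub hf.integrableOn) hupp r s hrs hs.2.le
  · intro r hr
    have h1 := integral_nonneg_of_ae
      (ae_restrict_of_ae_restrict_of_subset (hsub hr.2.le) hlow)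
    have h2 := integral_nonneg_of_ae
      (ae_restrict_of_ae_restrict_of_subset (hsub hr.2.le) hupp)
    rw [← hlowI r hr.2.le] at h1
    rw [← huppI r hr.2.le] at h2
    rw [abs_le]
    constructor <;> linarith

/-! ### Reduction of the convolution to ball integrals -/

lemma exists_uniformConvolution_eq {D : ℕ} {ι : Type*}
    (M : ι → Set (EuclideanSpace ℝ (Fin D))) (d : ι → ℕ)
    (p : EuclideanSpace ℝ (Fin D) → ℝ) (x : EuclideanSpace ℝ (Fin D)) :
    ∃ C > 0, ∀ δ, uniformConvolution M d p x δ = C * Real.exp (-(D : ℝ) * δ) *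
      ∫ y in Metric.ball x (Real.exp δ), p y
        ∂(Measure.sum fun j => riemannianMeasure (M j) (d j)) := by
  refine ⟨Real.pi ^ (-(D : ℝ) / 2) * Real.Gamma ((D : ℝ) / 2 + 1),
    mul_pos (Real.rpow_pos_of_pos Real.pi_pos _) (Real.Gamma_pos_of_pos (by positivity)),
    fun δ => ?_⟩
  rw [uniformConvolution, ← integral_indicator Metric.isOpen_ball.measurableSet,
    ← integral_const_mul]
  refine integral_congr_ae (ae_of_all _ fun y => ?_)
  have hiff : x - y ∈ Metric.ball (0 : EuclideanSpace ℝ (Fin D)) (Real.exp δ) ↔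
      y ∈ Metric.ball x (Real.exp δ) := by
    rw [mem_ball_zero_iff, mem_ball_iff_norm']
  simp only [uniformDensity]
  by_cases hy : y ∈ Metric.ball x (Real.exp δ)
  · rw [indicator_of_mem hy, indicator_of_mem (hiff.2 hy)]
    ring
  · rw [indicator_of_notMem hy, indicator_of_notMem (mt hiff.1 hy)]
    ring

/-- If the pieces `M j` are uniformly separated, then only one of them meets a small ball around
`x ∈ M i`. -/
lemma exists_sum_riemannianMeasure_restrict_ball {D : ℕ} {ι : Type*}
    {M : ι → Set (EuclideanSpace ℝ (Fin D))} {d : ι → ℕ}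
    (hM : ∀ j, IsEmbeddedSubmanifold (M j) (d j))
    (hξ : 0 < ⨅ (j : ι) (k : ι) (_ : j ≠ k) (y ∈ M j) (z ∈ M k), edist y z)
    {i : ι} {x : EuclideanSpace ℝ (Fin D)} (hx : x ∈ M i) :
    ∃ ε > 0, ∀ r < ε,
      (Measure.sum fun j => riemannianMeasure (M j) (d j)).restrict (Metric.ball x r) =
        (riemannianMeasure (M i) (d i)).restrict (Metric.ball x r) := by
  -- The separation may be infinite, so a finite positive number below it is chosen.
  obtain ⟨ε, hε, hεξ⟩ := ENNReal.lt_iff_exists_nnreal_btwn.1 hξ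
  refine ⟨ε, by exact_mod_cast hε, fun r hr => ?_⟩
  ext T hT
  have hb : MeasurableSet (Metric.ball x r) := Metric.isOpen_ball.measurableSet
  rw [Measure.restrict_apply hT, Measure.restrict_apply hT, Measure.sum_apply _ (hT.inter hb)]
  refine tsum_eq_single i fun j hj => measure_mono_null ?_ (ae_iff.1 (hM j).ae_mem)
  rintro y ⟨-, hy⟩ hyM
  have h1 : (⨅ (j : ι) (k : ι) (_ : j ≠ k) (y ∈ M j) (z ∈ M k), edist y z) ≤ edist y x :=
    iInf_le_of_le j <| iInf_le_of_le i <| iInf_le_of_le hj <| iInf_le_of_le y <|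
      iInf_le_of_le hyM <| iInf_le_of_le x <| iInf_le _ hx
  have h2 : edist y x < ε := by
    rw [edist_dist, ← ENNReal.ofReal_coe_nnreal]
    exact (ENNReal.ofReal_lt_ofReal_iff (by exact_mod_cast hε)).2 ((Metric.mem_ball.1 hy).trans hr)
  exact absurd (hεξ.trans_le h1) h2.not_gt

/-- The integral of `‖p‖` over the piece `M j` is `w j`, and these are summable. -/
lemma integrable_sum_riemannianMeasure {D : ℕ} {ι : Type*} [Countable ι]
    {M : ι → Set (EuclideanSpace ℝ (Fin D))} {d : ι → ℕ}
    (hM : ∀ j, IsEmbeddedSubmanifold (M j) (d j))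
    {w : ι → ℝ} (hw : ∀ j, 0 < w j) (hw_sum : Summable w)
    {q : ι → EuclideanSpace ℝ (Fin D) → ℝ}
    (hq : ∀ j, IsProbabilityDensityOn (M j) (d j) (q j))
    {p : EuclideanSpace ℝ (Fin D) → ℝ} (hp : ∀ j, ∀ y ∈ M j, p y = w j * q j y) :
    Integrable p (Measure.sum fun j => riemannianMeasure (M j) (d j)) := by
  have hae : ∀ j, ∀ᵐ y ∂(riemannianMeasure (M j) (d j)), p y = w j * q j y := fun j => by
    filter_upwards [(hM j).ae_mem] with y hy using hp j y hy
  refine integrable_sum_measure (fun j => ?_) ?_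
  · exact ((hq j).integrable.const_mul (w j)).congr ((hae j).mono fun y hy => hy.symm)
  · refine hw_sum.congr fun j => ?_
    have : ∫ y, ‖p y‖ ∂(riemannianMeasure (M j) (d j)) =
        ∫ y, w j * q j y ∂(riemannianMeasure (M j) (d j)) := by
      refine integral_congr_ae ?_
      filter_upwards [hae j, (hM j).ae_mem] with y hy hyM
      rw [hy, Real.norm_of_nonneg (mul_nonneg (hw j).le ((hq j).nonneg y hyM))]
    rw [this, integral_const_mul, (hq j).integral_eq_one, mul_one]

/-! ### Passage between the variables `δ` and `r = exp δ` -/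

section LogOfScaled

variable {H F : ℝ → ℝ} {C D : ℝ}

/-- For the forward direction the relation is solved for `F` at `r = exp δ`. The equivalence matches
the restricted filters in the two variables. -/
lemma differentiableAt_log_iff_of_eq_exp_mul (hC : 0 < C) (hF : ∀ r > 0, 0 < F r)
    (hH : ∀ δ, H δ = C * Real.exp (-D * δ) * F (Real.exp δ)) (δ : ℝ) :
    DifferentiableAt ℝ (fun t => Real.log (H t)) δ ↔ DifferentiableAt ℝ F (Real.exp δ) := by
  have hHpos : ∀ t, 0 < H t := fun t => by
    rw [hH]; exact mul_pos (by positivity) (hF _ (Real.exp_pos _))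
  constructor
  · intro h
    have h1 : DifferentiableAt ℝ (fun r => Real.exp (Real.log (H (Real.log r))) / C *
        Real.exp (D * Real.log r)) (Real.exp δ) := by
      have hl : DifferentiableAt ℝ Real.log (Real.exp δ) :=
        Real.differentiableAt_log (Real.exp_pos _).ne'
      have h2 : DifferentiableAt ℝ (fun r => Real.log (H (Real.log r))) (Real.exp δ) :=
        DifferentiableAt.comp (g := fun t => Real.log (H t)) (Real.exp δ)
          (by rwa [Real.log_exp]) hl
      exact (h2.exp.div_const C).mul (hl.const_mul D).exp
    refine h1.congr_of_eventuallyEq ?_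
    filter_upwards [lt_mem_nhds (Real.exp_pos δ)] with r hr
    rw [Real.exp_log (hHpos _), hH, Real.exp_log hr, neg_mul, Real.exp_neg]
    field_simp
  · intro h
    have h1 : H = fun t => C * Real.exp (-D * t) * F (Real.exp t) := funext hH
    refine DifferentiableAt.log ?_ (hHpos δ).ne'
    rw [h1]
    exact ((differentiableAt_id.const_mul (-D)).exp.const_mul C).mul
      (h.comp δ Real.differentiableAt_exp)

lemma deriv_log_of_eq_exp_mul (hC : 0 < C) (hF : ∀ r > 0, 0 < F r)
    (hH : ∀ δ, H δ = C * Real.exp (-D * δ) * F (Real.exp δ)) {δ : ℝ}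
    (hd : DifferentiableAt ℝ F (Real.exp δ)) :
    deriv (fun t => Real.log (H t)) δ =
      Real.exp δ * deriv F (Real.exp δ) / F (Real.exp δ) - D := by
  have h1 : (fun t => Real.log (H t)) =
      fun t => Real.log C + -D * t + Real.log (F (Real.exp t)) := by
    ext t
    have := hF _ (Real.exp_pos t)
    rw [hH, Real.log_mul (by positivity) this.ne', Real.log_mul hC.ne' (by positivity),
      Real.log_exp]
  have h2 : HasDerivAt (fun t => F (Real.exp t)) (deriv F (Real.exp δ) * Real.exp δ) δ :=
    hd.hasDerivAt.comp δ (Real.hasDerivAt_exp δ)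
  have h3 := (((hasDerivAt_id δ).const_mul (-D)).const_add (Real.log C)).add
    (h2.log (hF _ (Real.exp_pos δ)).ne')
  have h4 : deriv (fun t => Real.log C + -D * t + Real.log (F (Real.exp t))) δ = _ := h3.deriv
  rw [h1, h4]
  ring

/-- Lebesgue's theorem is applied to the monotone function `log ∘ F ∘ exp`, so no null set has to be
transported through `exp`. -/
lemma ae_differentiableAt_log_of_eq_exp_mul (hC : 0 < C) (hF : ∀ r > 0, 0 < F r)
    (hH : ∀ δ, H δ = C * Real.exp (-D * δ) * F (Real.exp δ)) (hmono : Monotone F) :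
    ∀ᵐ δ, DifferentiableAt ℝ (fun t => Real.log (H t)) δ := by
  have h1 : (fun t => Real.log (H t)) =
      fun t => Real.log C + -D * t + Real.log (F (Real.exp t)) := by
    ext t
    have := hF _ (Real.exp_pos t)
    rw [hH, Real.log_mul (by positivity) this.ne', Real.log_mul hC.ne' (by positivity),
      Real.log_exp]
  have h2 : Monotone fun t => Real.log (F (Real.exp t)) := fun a b hab =>
    Real.log_le_log (hF _ (Real.exp_pos a)) (hmono (Real.exp_le_exp.2 hab))
  rw [h1]
  filter_upwards [h2.ae_differentiableAt] with t ht
  exact ((differentiableAt_id.const_mul (-D)).const_add (Real.log C)).add ht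

end LogOfScaled

/-! ### The main theorem -/

theorem corollary2 {D : ℕ} {ι : Type*} [Countable ι]
    (M : ι → Set (EuclideanSpace ℝ (Fin D))) (d : ι → ℕ)
    (hM : ∀ j, IsEmbeddedSubmanifold (M j) (d j))
    (hξ : 0 < ⨅ (j : ι) (k : ι) (_ : j ≠ k) (y ∈ M j) (z ∈ M k), edist y z)
    (w : ι → ℝ) (hw : ∀ j, 0 < w j) (hw_sum : HasSum w 1)
    (q : ι → EuclideanSpace ℝ (Fin D) → ℝ)
    (hq : ∀ j, IsProbabilityDensityOn (M j) (d j) (q j))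
    (p : EuclideanSpace ℝ (Fin D) → ℝ) (hp : ∀ j, ∀ y ∈ M j, p y = w j * q j y)
    (i : ι) (x : EuclideanSpace ℝ (Fin D)) (hx : x ∈ M i)
    (hcont : ContinuousWithinAt (q i) (M i) x) (hpos : 0 < q i x) :
    -- the logarithm is that of a positive number, and is differentiable almost everywhere
    (∀ δ : ℝ, 0 < uniformConvolution M d p x δ) ∧
    (∀ᵐ δ : ℝ, DifferentiableAt ℝ (fun t => Real.log (uniformConvolution M d p x t)) δ) ∧
    -- the derivative, where it exists, tends to `d i - D` at `-∞`
    Tendsto (fun δ => deriv (fun t => Real.log (uniformConvolution M d p x t)) δ)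
      (atBot ⊓ 𝓟 {δ : ℝ |
        DifferentiableAt ℝ (fun t => Real.log (uniformConvolution M d p x t)) δ})
      (𝓝 ((d i : ℝ) - (D : ℝ))) ∧
    -- if `q i` is continuous on `M i` near `x`, the derivative exists at all very negative `δ`
    ((∃ V ∈ 𝓝 x, ContinuousOn (q i) (M i ∩ V)) →
      (∀ᶠ δ : ℝ in atBot,
        DifferentiableAt ℝ (fun t => Real.log (uniformConvolution M d p x t)) δ) ∧
      Tendsto (fun δ => deriv (fun t => Real.log (uniformConvolution M d p x t)) δ)
        atBot (𝓝 ((d i : ℝ) - (D : ℝ)))) := by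
  obtain ⟨C, hC, hH⟩ := exists_uniformConvolution_eq M d p x
  have hpi := integrable_sum_riemannianMeasure hM hw hw_sum.summable hq hp
  have hp0 : 0 ≤ᵐ[Measure.sum fun j => riemannianMeasure (M j) (d j)] p := by
    refine Measure.ae_sum_iff.2 fun j => ?_
    filter_upwards [(hM j).ae_mem] with y hy
    rw [Pi.zero_apply, hp j y hy]
    exact mul_nonneg (hw j).le ((hq j).nonneg y hy)
  obtain ⟨ε₀, hε₀, hloc⟩ := exists_sum_riemannianMeasure_restrict_ball hM hξ hx
  set ν := Measure.sum fun j => riemannianMeasure (M j) (d j) with hν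
  set μ := riemannianMeasure (M i) (d i) with hμ
  set F : ℝ → ℝ := fun r => ∫ y in Metric.ball x r, p y ∂ν with hF
  have hFloc : ∀ r < ε₀, F r = ∫ y in Metric.ball x r, p y ∂μ := fun r hr => by
    simp only [hF, hloc r hr]
  have hFev : ∀ r < ε₀, F =ᶠ[𝓝 r] fun r => ∫ y in Metric.ball x r, p y ∂μ := fun r hr => by
    filter_upwards [gt_mem_nhds hr] with s hs using hFloc s hs
  have hmono : Monotone F := fun r s hrs =>
    setIntegral_mono_set hpi.integrableOn (ae_restrict_of_ae hp0)
      (Metric.ball_subset_ball hrs).eventuallyLE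
  have hpx : 0 < p x := by rw [hp i x hx]; exact mul_pos (hw i) hpos
  have hpc : ContinuousWithinAt p (M i) x :=
    (continuousWithinAt_const.mul hcont).congr (hp i) (hp i x hx)
  have hpμ : Integrable p μ :=
    hpi.mono_measure (Measure.le_sum (fun j => riemannianMeasure (M j) (d j)) i)
  -- The comparison function `G`, the volume of small balls on `M i`, is the case of the constant
  -- density `1`.
  obtain ⟨hGd, hG⟩ := (hM i).deriv_setIntegral_ball hx (f := fun _ => (1 : ℝ)) univ_mem
    continuousOn_const
  obtain ⟨hGpos, hGlim⟩ := hG one_pos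
  have hlt : ∀ᶠ r in 𝓝[>] (0 : ℝ), r < ε₀ :=
    mem_nhdsWithin_of_mem_nhds (gt_mem_nhds hε₀)
  have hFpos : ∀ r > 0, 0 < F r := by
    intro r hr
    -- With `η = p x / 2`, `F s` is at least `p x / 2` times the volume of a small ball;
    -- monotonicity of `F` carries positivity to every radius `r`.
    obtain ⟨ε, hε, -, -, h⟩ := (hM i).setIntegral_ball_comparable hpμ hpc hpx (half_pos hpx)
    obtain ⟨s, ⟨hs1, hs2⟩, hs3, hs4⟩ := (((eventually_mem_set.2 (Ioo_mem_nhdsGT hε)).and hlt).and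
      (hGpos.and (eventually_mem_set.2 (Ioo_mem_nhdsGT hr)))).exists
    have h1 := (abs_le.1 (h s hs1)).1
    rw [← hFloc s hs2] at h1
    have h2 : 0 < p x * ∫ _ in Metric.ball x s, (1 : ℝ) ∂μ := mul_pos hpx hs3
    exact (show 0 < F s by linarith).trans_le (hmono hs4.2.le)
  have hiff := differentiableAt_log_iff_of_eq_exp_mul hC hFpos hH
  have hlim : Tendsto (fun r => r * deriv F r / F r)
      (𝓝[>] 0 ⊓ 𝓟 {r | DifferentiableAt ℝ F r}) (𝓝 (d i : ℝ)) := by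
    refine tendsto_logDeriv_of_comparable hpx (fun η hη => ?_) hGpos hGd hGlim
    obtain ⟨ε, hε, h1, h2, h3⟩ := (hM i).setIntegral_ball_comparable hpμ hpc hpx hη
    have hsub : Ioo 0 (min ε ε₀) ⊆ Ioo 0 ε := Ioo_subset_Ioo_right (min_le_left _ _)
    have hFe : ∀ r ∈ Ioo 0 (min ε ε₀), F r = ∫ y in Metric.ball x r, p y ∂μ :=
      fun r hr => hFloc r (hr.2.trans_le (min_le_right _ _))
    refine ⟨min ε ε₀, lt_min hε hε₀, (h1.mono hsub).congr fun r hr => ?_,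
      (h2.mono hsub).congr fun r hr => ?_, fun r hr => ?_⟩
    · simp only [hFe r hr]; rfl
    · simp only [hFe r hr]; rfl
    · rw [hFe r hr]; exact h3 r (hsub hr)
  have htend : Tendsto (fun δ => deriv (fun t => Real.log (uniformConvolution M d p x t)) δ)
      (atBot ⊓ 𝓟 {δ : ℝ |
        DifferentiableAt ℝ (fun t => Real.log (uniformConvolution M d p x t)) δ})
      (𝓝 ((d i : ℝ) - (D : ℝ))) := by
    have hexp : Tendsto Real.exp (atBot ⊓ 𝓟 {δ : ℝ |
        DifferentiableAt ℝ (fun t => Real.log (uniformConvolution M d p x t)) δ})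
        (𝓝[>] 0 ⊓ 𝓟 {r | DifferentiableAt ℝ F r}) :=
      Real.tendsto_exp_atBot_nhdsGT.inf (tendsto_principal_principal.2 fun δ hδ => (hiff δ).1 hδ)
    refine ((hlim.comp hexp).sub_const (D : ℝ)).congr' ?_
    filter_upwards [mem_inf_of_right (mem_principal_self _)] with δ hδ
    exact (deriv_log_of_eq_exp_mul hC hFpos hH ((hiff δ).1 hδ)).symm
  refine ⟨fun δ => ?_, ae_differentiableAt_log_of_eq_exp_mul hC hFpos hH hmono, htend, ?_⟩
  · rw [hH]
    exact mul_pos (mul_pos hC (Real.exp_pos _)) (hFpos _ (Real.exp_pos _))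
  · rintro ⟨V, hV, hqV⟩
    have hpV : ContinuousOn p (M i ∩ V) :=
      (continuousOn_const.mul hqV).congr fun y hy => hp i y hy.1
    have hdF : ∀ᶠ r in 𝓝[>] (0 : ℝ), DifferentiableAt ℝ F r := by
      filter_upwards [((hM i).deriv_setIntegral_ball hx hV hpV).1, hlt] with r hr hrε
      exact hr.congr_of_eventuallyEq (hFev r hrε)
    have hev : ∀ᶠ δ : ℝ in atBot,
        DifferentiableAt ℝ (fun t => Real.log (uniformConvolution M d p x t)) δ :=
      (Real.tendsto_exp_atBot_nhdsGT.eventually hdF).mono fun δ hδ => (hiff δ).2 hδ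
    refine ⟨hev, ?_⟩
    -- Differentiability holds eventually, so restricting the filter changes nothing.
    rwa [inf_eq_left.2 (le_principal_iff.2 hev)] at htend
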